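/- Let $L>0$, let $P_0,P_1,V_0,V_1\in\mathbb{R}^3$ with $|P_0-P_1|<L$ and $|V_0|=|V_1|=1$, and let $\mathcal{A}$ be the set of all $\gamma\in W^{2,2}(0,L;\mathbb{R}^3)$ (represented by their $C^1$ representatives on $[0,L]$) such that $|\gamma'|\equiv 1$, $\gamma(0)=P_0$, $\gamma(L)=P_1$, $\gamma'(0)=V_0$ and $\gamma'(L)=V_1$. For $\gamma\in\mathcal{A}$ let $\mathcal{B}[\gamma]=\int_0^L|\gamma''(s)|^2\,ds$ be the bending energy. Let $\gamma\in\mathcal{A}$, and suppose that there are $0\le s_1<s_2\le L$ with $s_2-s_1<L$ and a unit vector $\omega\in\mathbb{R}^3$ such that $\gamma(s_2)-\gamma(s_1)$, $\gamma'(s_1)$ and $\gamma'(s_2)$ are all orthogonal to $\omega$. Suppose moreover that $\gamma''(s_1)\cdot\omega\neq0$ or $\gamma''(s_2)\cdot\omega\neq0$, where $\gamma''(s_i)\cdot\omega\ne0$ means that the $C^1$ representative $\gamma$ has a classical second derivative at $s_i$ (one-sided if $s_i$ is an endpoint of $[0,L]$) whose inner product with $\omega$ is not zero. Then $\gamma$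 is not a global minimizer of $\mathcal{B}$ in $\mathcal{A}$. -/

import Mathlib

open MeasureTheory Set

noncomputable section

/-- Euclidean three-space. -/
abbrev E3 : Type := EuclideanSpace ℝ (Fin 3)

open scoped ContDiff in
/-- `v` is a weak derivative of `u` on the open interval `(0, L)`: both are locally integrable there
and `∫ φ' u = - ∫ φ v` for every smooth test function `φ` compactly supported in `(0, L)`. -/
structure IsWeakDeriv (L : ℝ) (u v : ℝ → E3) : Prop where
  locallyIntegrable_left : LocallyIntegrableOn u (Ioo 0 L)
  locallyIntegrable_right : LocallyIntegrableOn v (Ioo 0 L)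
  integral_eq : ∀ φ : ℝ → ℝ, ContDiff ℝ ∞ φ → HasCompactSupport φ → tsupport φ ⊆ Ioo 0 L →
    ∫ s in Ioo 0 L, deriv φ s • u s = - ∫ s in Ioo 0 L, φ s • v s

open Classical in
/-- The weak derivative of `u` on `(0, L)`. It is unique up to null sets, and one representative is
chosen (the value is `0` if `u` has no weak derivative). -/
def weakDeriv (L : ℝ) (u : ℝ → E3) : ℝ → E3 :=
  if h : ∃ v, IsWeakDeriv L u v then h.choose else 0

/-- Membership in the Sobolev space `W^{2,2}(0, L; ℝ³)`: the function and its weak derivatives of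
orders one and two exist and are square integrable on `(0, L)`. -/
def MemW22 (L : ℝ) (γ : ℝ → E3) : Prop :=
  MemLp γ 2 (volume.restrict (Ioo 0 L)) ∧
    ∃ g h : ℝ → E3, IsWeakDeriv L γ g ∧ IsWeakDeriv L g h ∧
      MemLp g 2 (volume.restrict (Ioo 0 L)) ∧ MemLp h 2 (volume.restrict (Ioo 0 L))

/-- The classical first derivative of a curve on `[0, L]`, one-sided at the endpoints. -/
def tangent (L : ℝ) (γ : ℝ → E3) : ℝ → E3 :=
  derivWithin γ (Icc 0 L)

/-- `W^{2,2}_arc(0, L; ℝ³)`: arclength parameterized curves of class `W^{2,2}` and length `L`.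
An element of `W^{2,2}(0, L; ℝ³)` is represented by its unique representative of class `C^1` on
`[0, L]`. The values of `γ` outside `[0, L]` play no role. -/
structure IsArclengthW22 (L : ℝ) (γ : ℝ → E3) : Prop where
  memW22 : MemW22 L γ
  contDiffOn : ContDiffOn ℝ 1 γ (Icc 0 L)
  norm_tangent : ∀ s ∈ Icc 0 L, ‖tangent L γ s‖ = 1

/-- The admissible set of the clamped boundary condition. -/
def clampedCurves (L : ℝ) (P₀ P₁ V₀ V₁ : E3) : Set (ℝ → E3) :=
  {γ | IsArclengthW22 L γ ∧ γ 0 = P₀ ∧ γ L = P₁ ∧ tangent L γ 0 = V₀ ∧ tangent L γ L = V₁}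

/-- The bending energy `∫ |γ''|² ds` over `(0, L)`, with `γ''` the second weak derivative. -/
def bendingEnergy (L : ℝ) (γ : ℝ → E3) : ℝ :=
  ∫ s in Ioo 0 L, ‖weakDeriv L (weakDeriv L γ) s‖ ^ 2

end

/-! Reflect the arc of γ between s₁ and s₂ in the plane orthogonal to ω. By the orthogonality
hypotheses the tangents still match at s₁ and s₂ and the displacement is unchanged, so the reflected
curve is admissible with the same energy (`IsIndicatrix.reflect`). If γ were a minimizer, both
curves would be, and both tangents would satisfy T'' = -q T + c with q continuous
(`IsIndicatrix.exists_euler_lagrange`). As s₂ - s₁ < L, one of s₁, s₂ is an interior point σ of [0,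
L]. There f = ⟨T, ω⟩ and its reflected counterpart are equal on one side and opposite on the other.
Comparing derivatives up to order two at σ gives f(σ) = f'(σ) = 0 and ⟨c, ω⟩ = 0, so f solves f'' =
-q f with zero Cauchy data and vanishes identically (`eqOn_zero_of_reflected`). Then γ''·ω vanishes
at s₁ and s₂, a contradiction.

The Euler-Lagrange equation comes from the variations exp(∑ aᵢ Xᵢ) T, where the Xᵢ are smooth fields
of skew operators vanishing at 0 and L. They preserve |T| = 1 and the clamped directions, so the
only constraint left is the displacement, and the finite-dimensional Lagrange multiplier rule
applies in the parameters aᵢ. One multiplier serves all fields because the first variations lie in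
the finite-dimensional space E × ℝ. An abnormal multiplier would force a constant tangent, which |P₀
- P₁| < L excludes. A du Bois-Reymond argument then upgrades the weak equation to the classical one.
-/

/-! ### Absolutely continuous functions and primitives. -/

section AbsolutelyContinuous

variable {X Y Z G H : Type*} [PseudoMetricSpace X] [PseudoMetricSpace Y] [PseudoMetricSpace Z]
  [NormedAddCommGroup G] [NormedSpace ℝ G] [NormedAddCommGroup H] [NormedSpace ℝ H]

/-- A function whose increments are controlled by those of two absolutely continuous functions is
absolutely continuous. -/
theorem AbsolutelyContinuousOnInterval.of_dist_le {f : ℝ → X} {g : ℝ → Y} {h : ℝ → Z} {a b : ℝ}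
    (hf : AbsolutelyContinuousOnInterval f a b) (hg : AbsolutelyContinuousOnInterval g a b)
    (C D : ℝ) (hh : ∀ x ∈ uIcc a b, ∀ y ∈ uIcc a b,
      dist (h x) (h y) ≤ C * dist (f x) (f y) + D * dist (g x) (g y)) :
    AbsolutelyContinuousOnInterval h a b := by
  unfold AbsolutelyContinuousOnInterval at hf hg ⊢
  have hlim := (hf.const_mul C).add (hg.const_mul D)
  simp only [mul_zero, add_zero] at hlim
  refine squeeze_zero' ?_ ?_ hlim
  · exact Filter.Eventually.of_forall fun _ ↦ Finset.sum_nonneg fun i _ ↦ dist_nonneg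
  · rw [Filter.eventually_inf_principal]
    filter_upwards with E hE
    simp only [Finset.mul_sum, ← Finset.sum_add_distrib]
    exact Finset.sum_le_sum fun i hi ↦ hh _ (hE.1 i hi).1 _ (hE.1 i hi).2

/-- The indefinite integral of an integrable vector valued function is absolutely continuous. -/
theorem IntervalIntegrable.absolutelyContinuousOnInterval_integral {v : ℝ → G} {a b : ℝ}
    (hv : IntervalIntegrable v volume a b) :
    AbsolutelyContinuousOnInterval (fun x ↦ ∫ t in a..x, v t) a b := by
  have hn := hv.norm.absolutelyContinuousOnInterval_intervalIntegral (c := a) (by simp)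
  refine hn.of_dist_le hn 1 0 fun x hx y hy ↦ ?_
  have hsub : ∀ {z}, z ∈ uIcc a b → uIcc a z ⊆ uIcc a b := fun hz ↦
    uIcc_subset_uIcc (by simp) hz
  have hi : ∀ {z}, z ∈ uIcc a b → IntervalIntegrable v volume a z := fun hz ↦
    hv.mono_set (hsub hz)
  rw [dist_eq_norm, dist_eq_norm, intervalIntegral.integral_interval_sub_left (hi hx) (hi hy),
    intervalIntegral.integral_interval_sub_left (hi hx).norm (hi hy).norm]
  simpa using intervalIntegral.norm_integral_le_abs_integral_norm (f := v) (a := y) (b := x)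

/-- `u` is a primitive of the integrable function `v` on `[0, L]`. -/
structure IsPrimitive (L : ℝ) (u v : ℝ → G) : Prop where
  intervalIntegrable : IntervalIntegrable v volume 0 L
  eq_add_integral : ∀ s ∈ Icc 0 L, u s = u 0 + ∫ t in 0..s, v t

variable {L : ℝ} {u v : ℝ → G}

theorem AbsolutelyContinuousOnInterval.congr {f g : ℝ → X} {a b : ℝ}
    (hf : AbsolutelyContinuousOnInterval f a b) (h : ∀ x ∈ uIcc a b, g x = f x) :
    AbsolutelyContinuousOnInterval g a b :=
  hf.of_dist_le hf 1 0 fun x hx y hy ↦ by simp [h x hx, h y hy]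

namespace IsPrimitive

theorem absolutelyContinuous (h : IsPrimitive L u v) (hL : 0 ≤ L) :
    AbsolutelyContinuousOnInterval u 0 L := by
  have hi := h.intervalIntegrable.absolutelyContinuousOnInterval_integral
  refine hi.of_dist_le hi 1 0 fun x hx y hy ↦ ?_
  rw [uIcc_of_le hL] at hx hy
  rw [h.eq_add_integral x hx, h.eq_add_integral y hy]
  simp

theorem continuousOn (h : IsPrimitive L u v) (hL : 0 ≤ L) : ContinuousOn u (Icc 0 L) := by
  simpa [uIcc_of_le hL] using (h.absolutelyContinuous hL).continuousOn

theorem ae_hasDerivAt [CompleteSpace G] (h : IsPrimitive L u v) (hL : 0 ≤ L) :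
    ∀ᵐ x, x ∈ Ioo 0 L → HasDerivAt u (v x) x := by
  filter_upwards [h.intervalIntegrable.ae_hasDerivAt_integral] with x hx hxL
  have h1 := (hx (by simpa [uIcc_of_le hL] using Ioo_subset_Icc_self hxL) 0
    (by simp)).const_add (u 0)
  refine h1.congr_of_eventuallyEq ?_
  filter_upwards [Ioo_mem_nhds hxL.1 hxL.2] with y hy
  exact h.eq_add_integral y (Ioo_subset_Icc_self hy)

/-- An absolutely continuous function is a primitive of its almost everywhere derivative. -/
theorem of_ae_hasDerivAt [CompleteSpace G] (hL : 0 ≤ L)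
    (hu : AbsolutelyContinuousOnInterval u 0 L)
    (hv : IntervalIntegrable v volume 0 L) (h : ∀ᵐ x, x ∈ Ioo 0 L → HasDerivAt u (v x) x) :
    IsPrimitive L u v := by
  refine ⟨hv, fun s hs ↦ ?_⟩
  have hi := hv.absolutelyContinuousOnInterval_integral
  have hd : AbsolutelyContinuousOnInterval (fun x ↦ u x - ∫ t in 0..x, v t) 0 L := hu.sub hi
  obtain ⟨c, hc⟩ := hd.const_of_ae_hasDerivAt_zero (by
    have h₁ : ∀ᵐ x : ℝ, x ≠ 0 := by simp [ae_iff, measure_singleton]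
    have h₂ : ∀ᵐ x : ℝ, x ≠ L := by simp [ae_iff, measure_singleton]
    filter_upwards [h, hv.ae_hasDerivAt_integral, h₁, h₂] with x hx hx' h0 hL' hxI
    have hxI' := hxI
    rw [uIcc_of_le hL] at hxI'
    have hm : x ∈ Ioo 0 L := ⟨lt_of_le_of_ne hxI'.1 (Ne.symm h0), lt_of_le_of_ne hxI'.2 hL'⟩
    have hs := (hx hm).fun_sub (hx' hxI 0 (by simp))
    rwa [sub_self] at hs)
  have h0 := hc 0 (by simp)
  have hs' := hc s (by rwa [uIcc_of_le hL])
  simp only [intervalIntegral.integral_same, sub_zero] at h0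
  rw [h0, ← hs', sub_add_cancel]

/-- The product rule for a `C¹` family of operators applied to a primitive. -/
theorem clm_apply [CompleteSpace G] [CompleteSpace H] (h : IsPrimitive L u v) (hL : 0 ≤ L)
    {Φ : ℝ → G →L[ℝ] H} (hΦ : ContDiff ℝ 1 Φ) :
    IsPrimitive L (fun s ↦ Φ s (u s)) (fun s ↦ deriv Φ s (u s) + Φ s (v s)) := by
  have hΦac : AbsolutelyContinuousOnInterval Φ 0 L :=
    hΦ.contDiffOn.absolutelyContinuousOnInterval
  have huac := h.absolutelyContinuous hL
  refine of_ae_hasDerivAt hL ?_ ?_ ?_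
  · obtain ⟨C, hC⟩ := huac.exists_bound
    obtain ⟨D, hD⟩ := hΦac.exists_bound
    refine hΦac.of_dist_le huac C D fun x hx y hy ↦ ?_
    have : Φ x (u x) - Φ y (u y) = (Φ x - Φ y) (u x) + Φ y (u x - u y) := by simp
    rw [dist_eq_norm, dist_eq_norm, dist_eq_norm, this]
    refine (norm_add_le _ _).trans (add_le_add ?_ ?_)
    · rw [mul_comm]
      exact ((Φ x - Φ y).le_opNorm _).trans
        (mul_le_mul_of_nonneg_left (hC x hx) (norm_nonneg _))
    · exact ((Φ y).le_opNorm _).trans (mul_le_mul_of_nonneg_right (hD y hy) (norm_nonneg _))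
  · refine IntervalIntegrable.add ?_ ?_
    · refine ContinuousOn.intervalIntegrable ?_
      exact (hΦ.continuous_deriv le_rfl).continuousOn.clm_apply huac.continuousOn
    · have := h.intervalIntegrable
      rw [intervalIntegrable_iff] at this ⊢
      obtain ⟨D, hD⟩ := hΦac.exists_bound
      refine Integrable.mono' (this.norm.const_mul D) ?_ ?_
      · exact (ContinuousLinearMap.apply ℝ H).flip.aestronglyMeasurable_comp₂
          hΦ.continuous.aestronglyMeasurable this.1
      · filter_upwards [ae_restrict_mem measurableSet_uIoc] with x hx
        exact ((Φ x).le_opNorm _).trans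
          (mul_le_mul_of_nonneg_right (hD x (uIoc_subset_uIcc hx)) (norm_nonneg _))
  · filter_upwards [h.ae_hasDerivAt hL] with x hx hxL
    exact ((hΦ.differentiable one_ne_zero x).hasDerivAt).clm_apply (hx hxL)

end IsPrimitive

end AbsolutelyContinuous

/-- The one-sided fundamental theorem of calculus on a closed interval. -/
theorem hasDerivWithinAt_integral_Icc {G : Type*} [NormedAddCommGroup G] [NormedSpace ℝ G]
    [CompleteSpace G] {L : ℝ} {n : ℝ → G} (hn : ContinuousOn n (Icc 0 L)) {s : ℝ}
    (hs : s ∈ Icc 0 L) :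
    HasDerivWithinAt (fun x ↦ ∫ t in 0..x, n t) (n s) (Icc 0 L) s := by
  have hL : 0 ≤ L := hs.1.trans hs.2
  -- Extending `n` by constants makes it continuous on the whole line, so the two-sided fundamental
  -- theorem also covers the endpoints.
  set N : ℝ → G := IccExtend hL ((Icc 0 L).domRestrict n) with hN
  have hNc : Continuous N := hn.domRestrict.Icc_extend'
  have hNe : ∀ x ∈ Icc 0 L, N x = n x := fun x hx ↦ by
    rw [hN, IccExtend_of_mem _ _ hx, domRestrict_apply]
  have h := (hNc.integral_hasStrictDerivAt 0 s).hasDerivAt.hasDerivWithinAt (s := Icc 0 L)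
  rw [hNe s hs] at h
  refine h.congr_of_mem (fun x hx ↦ ?_) hs
  refine intervalIntegral.integral_congr fun t ht ↦ (hNe t ?_).symm
  rw [uIcc_of_le hx.1] at ht
  exact ⟨ht.1, ht.2.trans hx.2⟩

/-! ### Test functions on (0, L). -/

section TestFunctions

open scoped ContDiff

/-- Smooth test functions compactly supported in `(0, L)`. -/
structure IsTest (L : ℝ) (φ : ℝ → ℝ) : Prop where
  contDiff : ContDiff ℝ ∞ φ
  hasCompactSupport : HasCompactSupport φ
  tsupport_subset : tsupport φ ⊆ Ioo 0 L

variable {L : ℝ} {φ ψ : ℝ → ℝ}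

theorem IsTest.eq_zero (h : IsTest L φ) {s : ℝ} (hs : s ∉ Ioo 0 L) : φ s = 0 :=
  image_eq_zero_of_notMem_tsupport fun h' ↦ hs (h.tsupport_subset h')

theorem IsTest.exists_Icc (h : IsTest L φ) :
    ∃ a b, 0 < a ∧ b < L ∧ ∀ s, s ∉ Icc a b → φ s = 0 := by
  rcases (tsupport φ).eq_empty_or_nonempty with he | hne
  -- For φ = 0 any pair with 0 < a and b < L will do; the interval may be empty.
  · exact ⟨1, L - 1, one_pos, by linarith, fun s _ ↦
      image_eq_zero_of_notMem_tsupport (by simp [he])⟩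
  · have hc : IsCompact (tsupport φ) := h.hasCompactSupport
    obtain ⟨a, ha⟩ := hc.exists_isLeast hne
    obtain ⟨b, hb⟩ := hc.exists_isGreatest hne
    exact ⟨a, b, (h.tsupport_subset ha.1).1, (h.tsupport_subset hb.1).2, fun s hs ↦
      image_eq_zero_of_notMem_tsupport fun hs' ↦ hs ⟨ha.2 hs', hb.2 hs'⟩⟩

theorem isTest_of_forall {a b : ℝ} (hφ : ContDiff ℝ ∞ φ) (ha : 0 < a) (hb : b < L)
    (h : ∀ s, s ∉ Icc a b → φ s = 0) : IsTest L φ := by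
  have hs : tsupport φ ⊆ Icc a b :=
    closure_minimal (fun s hs ↦ by_contra fun h' ↦ hs (h s h')) isClosed_Icc
  exact ⟨hφ, isCompact_Icc.of_isClosed_subset (isClosed_tsupport φ) hs,
    hs.trans fun x hx ↦ ⟨ha.trans_le hx.1, hx.2.trans_lt hb⟩⟩

theorem IsTest.sub (hφ : IsTest L φ) (hψ : IsTest L ψ) (c : ℝ) :
    IsTest L (fun s ↦ φ s - c * ψ s) := by
  obtain ⟨a, b, ha, hb, h⟩ := hφ.exists_Icc
  obtain ⟨a', b', ha', hb', h'⟩ := hψ.exists_Icc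
  refine isTest_of_forall (hφ.contDiff.sub (contDiff_const.mul hψ.contDiff)) (lt_min ha ha')
    (max_lt hb hb') fun s hs ↦ ?_
  rw [h s, h' s]
  · simp
  · exact fun hs' ↦ hs ⟨(min_le_right _ _).trans hs'.1, hs'.2.trans (le_max_right _ _)⟩
  · exact fun hs' ↦ hs ⟨(min_le_left _ _).trans hs'.1, hs'.2.trans (le_max_left _ _)⟩

theorem exists_isTest_integral_eq_one (hL : 0 < L) :
    ∃ ψ : ℝ → ℝ, IsTest L ψ ∧ ∫ s in Ioo 0 L, ψ s = 1 := by
  let f : ContDiffBump (L / 2) := ⟨L / 8, L / 4, by linarith, by linarith⟩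
  have ht : IsTest L (f.normed volume) := by
    refine ⟨f.contDiff_normed, f.hasCompactSupport_normed, ?_⟩
    rw [f.tsupport_normed_eq, Real.closedBall_eq_Icc]
    intro x hx
    simp only [f] at hx
    exact ⟨by linarith [hx.1], by linarith [hx.2]⟩
  refine ⟨_, ht, ?_⟩
  rw [setIntegral_eq_integral_of_forall_compl_eq_zero fun x hx ↦ ht.eq_zero hx]
  exact f.integral_normed

theorem integral_Ioo_eq_intervalIntegral {G : Type*} [NormedAddCommGroup G] [NormedSpace ℝ G]
    (hL : 0 ≤ L) (f : ℝ → G) : ∫ s in Ioo 0 L, f s = ∫ s in 0..L, f s := by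
  rw [intervalIntegral.integral_of_le hL, integral_Ioc_eq_integral_Ioo]

/-- The primitive from `0` vanishes to the left of the support of `ψ`; the zero mean makes it vanish
to the right as well. -/
theorem IsTest.exists_primitive (hL : 0 < L) (hψ : IsTest L ψ) (h0 : ∫ s in Ioo 0 L, ψ s = 0) :
    ∃ φ, IsTest L φ ∧ deriv φ = ψ := by
  have hc := hψ.contDiff.continuous
  have hd : ∀ s, HasDerivAt (fun x ↦ ∫ t in 0..x, ψ t) (ψ s) s := fun s ↦
    (hc.integral_hasStrictDerivAt 0 s).hasDerivAt
  have hderiv : deriv (fun x ↦ ∫ t in 0..x, ψ t) = ψ := funext fun s ↦ (hd s).deriv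
  refine ⟨fun x ↦ ∫ t in 0..x, ψ t, ?_, hderiv⟩
  obtain ⟨a, b, ha, hb, h⟩ := hψ.exists_Icc
  refine isTest_of_forall (a := a) (b := b) ?_ ha hb fun s hs ↦ ?_
  · rw [contDiff_infty_iff_deriv, hderiv]
    exact ⟨fun s ↦ (hd s).differentiableAt, hψ.contDiff⟩
  · have hz : ∀ x y : ℝ, (∀ t ∈ uIcc x y, t ∉ Icc a b) → ∫ t in x..y, ψ t = 0 := fun x y hxy ↦ by
      rw [intervalIntegral.integral_congr (g := fun _ ↦ (0 : ℝ)) fun t ht ↦ h t (hxy t ht)]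
      simp
    rcases lt_or_ge s a with hsa | hsa
    · refine hz 0 s fun t ht ht' ↦ ?_
      have := ht.2
      have h2 := ht'.1
      rcases le_max_iff.1 this with h | h <;> linarith
    · have hsb : b < s := by
        by_contra hsb
        exact hs ⟨hsa, not_lt.1 hsb⟩
      rw [integral_Ioo_eq_intervalIntegral hL.le] at h0
      have hi : ∀ x y : ℝ, IntervalIntegrable ψ volume x y := fun x y ↦ hc.intervalIntegrable x y
      rw [← intervalIntegral.integral_add_adjacent_intervals (hi 0 L) (hi L s), h0, zero_add]
      refine hz L s fun t ht ht' ↦ ?_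
      have := ht.1
      have h2 := ht'.2
      rcases min_le_iff.1 this with h | h <;> linarith

end TestFunctions

/-! ### Weak derivatives and the du Bois-Reymond lemma. -/

section WeakDerivatives

variable {G : Type*} [NormedAddCommGroup G] [NormedSpace ℝ G] {L : ℝ} {u v w : ℝ → G}

/-- `∫ φ' u = -∫ φ v` for all test functions `φ` on `(0, L)`. -/
def IntegratesByParts (L : ℝ) (u v : ℝ → G) : Prop :=
  ∀ φ, IsTest L φ → ∫ s in Ioo 0 L, deriv φ s • u s = - ∫ s in Ioo 0 L, φ s • v s

omit [NormedSpace ℝ G] in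
theorem IntervalIntegrable.integrable_Ioo (hL : 0 ≤ L) (hv : IntervalIntegrable v volume 0 L) :
    Integrable v (volume.restrict (Ioo 0 L)) :=
  (intervalIntegrable_iff_integrableOn_Ioo_of_le hL).1 hv

theorem Continuous.integrable_smul_Ioo (hv : Integrable v (volume.restrict (Ioo 0 L)))
    {φ : ℝ → ℝ} (hφ : Continuous φ) :
    Integrable (fun s ↦ φ s • v s) (volume.restrict (Ioo 0 L)) := by
  obtain ⟨C, hC⟩ := (isCompact_Icc (a := (0 : ℝ)) (b := L)).exists_bound_of_continuousOn
    hφ.continuousOn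
  refine hv.bdd_smul C hφ.aestronglyMeasurable ?_
  filter_upwards [ae_restrict_mem measurableSet_Ioo] with x hx using hC x (Ioo_subset_Icc_self hx)

theorem IsPrimitive.integratesByParts [CompleteSpace G] (hL : 0 ≤ L) (h : IsPrimitive L u v) :
    IntegratesByParts L u v := by
  intro φ hφ
  have hφ1 : ContDiff ℝ 1 φ := hφ.contDiff.of_le (by exact_mod_cast le_top)
  have hp := h.clm_apply (H := G) hL (Φ := fun s ↦ φ s • ContinuousLinearMap.id ℝ G)
    (hφ1.smul contDiff_const)
  have h1 := hp.eq_add_integral L ⟨hL, le_rfl⟩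
  have hd : ∀ s, deriv (fun s ↦ φ s • ContinuousLinearMap.id ℝ G) s =
      deriv φ s • ContinuousLinearMap.id ℝ G := fun s ↦
    ((hφ1.differentiable one_ne_zero s).hasDerivAt.smul_const (ContinuousLinearMap.id ℝ G)).deriv
  simp only [hd, hφ.eq_zero (s := 0) (by simp), hφ.eq_zero (s := L) (by simp),
    smul_apply, ContinuousLinearMap.id_apply, zero_smul,
    zero_apply, zero_add] at h1
  rw [← integral_Ioo_eq_intervalIntegral hL, integral_add] at h1
  · exact eq_neg_of_add_eq_zero_left h1.symm
  · refine (Continuous.integrable_smul_Ioo ?_ (hφ1.continuous_deriv le_rfl))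
    exact ((h.continuousOn hL).integrableOn_Icc).mono_set Ioo_subset_Icc_self
  · exact (Continuous.integrable_smul_Ioo (h.intervalIntegrable.integrable_Ioo hL) hφ1.continuous)

/-- Fix a test function ψ of integral 1. For any test function χ, the difference χ - (∫ χ) ψ has
mean zero and so is the derivative of a test function; hence ∫ χ (w - c) = 0 with c = ∫ ψ w. -/
theorem ae_eq_const_of_integral_deriv_smul_eq_zero [CompleteSpace G] (hL : 0 < L)
    (hw : Integrable w (volume.restrict (Ioo 0 L)))
    (h : ∀ φ, IsTest L φ → ∫ s in Ioo 0 L, deriv φ s • w s = 0) :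
    ∃ c, ∀ᵐ s ∂volume.restrict (Ioo 0 L), w s = c := by
  obtain ⟨ψ, hψ, hψ1⟩ := exists_isTest_integral_eq_one hL
  set c := ∫ s in Ioo 0 L, ψ s • w s with hc
  refine ⟨c, ?_⟩
  have hfin : IsFiniteMeasure (volume.restrict (Ioo 0 L)) := by infer_instance
  have hwc : Integrable (fun s ↦ w s - c) (volume.restrict (Ioo 0 L)) :=
    hw.sub (integrable_const c)
  have h0 := isOpen_Ioo.ae_eq_zero_of_integral_contDiff_smul_eq_zero (U := Ioo 0 L)
    (f := fun s ↦ w s - c) (μ := volume) (IntegrableOn.locallyIntegrableOn hwc) (by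
      intro χ h1 h2 h3
      have hχ : IsTest L χ := ⟨h1, h2, h3⟩
      rw [← setIntegral_eq_integral_of_forall_compl_eq_zero (s := Ioo 0 L)
        fun x hx ↦ by rw [hχ.eq_zero hx, zero_smul]]
      set I := ∫ s in Ioo 0 L, χ s with hI
      have hone : Integrable (fun _ : ℝ ↦ (1 : ℝ)) (volume.restrict (Ioo 0 L)) :=
        integrable_const 1
      have hχi : Integrable χ (volume.restrict (Ioo 0 L)) := by
        simpa using Continuous.integrable_smul_Ioo hone hχ.contDiff.continuous
      have hψi : Integrable ψ (volume.restrict (Ioo 0 L)) := by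
        simpa using Continuous.integrable_smul_Ioo hone hψ.contDiff.continuous
      have hχw := Continuous.integrable_smul_Ioo hw hχ.contDiff.continuous
      have hψw := Continuous.integrable_smul_Ioo hw hψ.contDiff.continuous
      obtain ⟨φ, hφ, hφ'⟩ := (hχ.sub hψ I).exists_primitive hL (by
        rw [integral_sub hχi (hψi.const_mul I), integral_const_mul, hψ1, mul_one, sub_self])
      have h4 := h φ hφ
      simp only [hφ', sub_smul, mul_smul] at h4
      rw [integral_sub hχw (hψw.fun_smul I), integral_smul, ← hc] at h4
      simp only [smul_sub]
      rw [integral_sub hχw (hχi.smul_const c), integral_smul_const]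
      exact h4)
  rw [ae_restrict_iff' measurableSet_Ioo]
  filter_upwards [h0] with s hs hsI using sub_eq_zero.1 (hs hsI)

/-- A function with an integrable weak derivative agrees almost everywhere with a primitive. -/
theorem IntegratesByParts.ae_eq_const_add_integral [CompleteSpace G] (hL : 0 < L)
    (hu : Integrable u (volume.restrict (Ioo 0 L))) (hv : IntervalIntegrable v volume 0 L)
    (h : IntegratesByParts L u v) :
    ∃ c, ∀ᵐ s ∂volume.restrict (Ioo 0 L), u s = c + ∫ t in 0..s, v t := by
  have hp : IsPrimitive L (fun s ↦ ∫ t in 0..s, v t) v := ⟨hv, fun s _ ↦ by simp⟩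
  have hpi : Integrable (fun s ↦ ∫ t in 0..s, v t) (volume.restrict (Ioo 0 L)) :=
    ((hp.continuousOn hL.le).integrableOn_Icc).mono_set Ioo_subset_Icc_self
  obtain ⟨c, hc⟩ := ae_eq_const_of_integral_deriv_smul_eq_zero hL (hu.sub hpi) (by
    intro φ hφ
    have hd : Continuous (deriv φ) :=
      hφ.contDiff.continuous_deriv (by exact_mod_cast le_top)
    simp only [Pi.sub_apply, smul_sub]
    rw [integral_sub (Continuous.integrable_smul_Ioo hu hd)
      (Continuous.integrable_smul_Ioo hpi hd), h φ hφ, hp.integratesByParts hL.le φ hφ, sub_self])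
  refine ⟨c, ?_⟩
  filter_upwards [hc] with s hs
  rw [← hs]
  simp

omit [NormedSpace ℝ G] in
/-- Two functions which are continuous on `[0, L]` and agree almost everywhere in `(0, L)` agree on
`[0, L]`. -/
theorem eqOn_Icc_of_ae_eq (hL : 0 < L) (hu : ContinuousOn u (Icc 0 L))
    (hv : ContinuousOn v (Icc 0 L)) (h : ∀ᵐ s ∂volume.restrict (Ioo 0 L), u s = v s) :
    EqOn u v (Icc 0 L) := by
  have h1 : EqOn u v (Ioo 0 L) :=
    Measure.eqOn_open_of_ae_eq h isOpen_Ioo (hu.mono Ioo_subset_Icc_self)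
      (hv.mono Ioo_subset_Icc_self)
  rw [← closure_Ioo hL.ne] at hu hv ⊢
  exact h1.of_subset_closure hu hv subset_closure subset_rfl

end WeakDerivatives

/-! ### Tangent indicatrices. -/

section Indicatrix

variable {G : Type*} [NormedAddCommGroup G] [NormedSpace ℝ G] {L : ℝ} {u v : ℝ → G}

theorem isPrimitive_of_continuousOn [CompleteSpace G] (hL : 0 ≤ L) (hu : ContinuousOn v (Icc 0 L))
    (hd : ∀ s ∈ Icc 0 L, HasDerivWithinAt u (v s) (Icc 0 L) s) : IsPrimitive L u v := by
  refine ⟨(hu.mono (by rw [uIcc_of_le hL])).intervalIntegrable, fun s hs ↦ ?_⟩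
  have hsub : Icc 0 s ⊆ Icc 0 L := Icc_subset_Icc_right hs.2
  rw [intervalIntegral.integral_eq_sub_of_hasDeriv_right_of_le (f := u) hs.1
    (fun x hx ↦ ((hd x (hsub hx)).mono hsub).continuousWithinAt) (fun x hx ↦ ?_)
    ((hu.mono (by rw [uIcc_of_le hs.1]; exact hsub)).intervalIntegrable)]
  · simp
  · exact ((hd x (hsub (Ioo_subset_Icc_self hx))).hasDerivAt
      (Icc_mem_nhds hx.1 (hx.2.trans_le hs.2))).hasDerivWithinAt

omit [NormedSpace ℝ G] in
theorem MeasureTheory.MemLp.intervalIntegrable (hL : 0 ≤ L)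
    (hv : MemLp v 2 (volume.restrict (Ioo 0 L))) : IntervalIntegrable v volume 0 L :=
  (intervalIntegrable_iff_integrableOn_Ioo_of_le hL).2 (hv.integrable one_le_two)

omit [NormedSpace ℝ G] in
theorem ContinuousOn.memLp_Ioo {p : ENNReal} (hu : ContinuousOn u (Icc 0 L)) :
    MemLp u p (volume.restrict (Ioo 0 L)) := by
  obtain ⟨C, hC⟩ := isCompact_Icc.exists_bound_of_continuousOn hu
  refine MemLp.of_bound ((hu.mono Ioo_subset_Icc_self).aestronglyMeasurable measurableSet_Ioo) C ?_
  filter_upwards [ae_restrict_mem measurableSet_Ioo] with x hx using hC x (Ioo_subset_Icc_self hx)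

/-- A tangent indicatrix `T` together with its curvature vector `k`, of an arclength parametrized
curve of class `W^{2,2}` with clamped ends and displacement `P`. -/
structure IsIndicatrix (L : ℝ) (P V₀ V₁ : G) (T k : ℝ → G) : Prop where
  memLp : MemLp k 2 (volume.restrict (Ioo 0 L))
  isPrimitive : IsPrimitive L T k
  norm_eq_one : ∀ s ∈ Icc 0 L, ‖T s‖ = 1
  left : T 0 = V₀
  right : T L = V₁
  integral_eq : ∫ s in 0..L, T s = P

end Indicatrix

/-! ### Uniqueness of weak derivatives and the bending energy. -/

section Sobolev

variable {L : ℝ} {u u' v v' : ℝ → E3}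

theorem IsWeakDeriv.integratesByParts (h : IsWeakDeriv L u v) : IntegratesByParts L u v :=
  fun φ hφ ↦ h.integral_eq φ hφ.contDiff hφ.hasCompactSupport hφ.tsupport_subset

theorem IntegratesByParts.isWeakDeriv (h : IntegratesByParts L u v)
    (hu : LocallyIntegrableOn u (Ioo 0 L)) (hv : LocallyIntegrableOn v (Ioo 0 L)) :
    IsWeakDeriv L u v :=
  ⟨hu, hv, fun φ h1 h2 h3 ↦ h φ ⟨h1, h2, h3⟩⟩

theorem IsTest.integrable_smul (hv : LocallyIntegrableOn v (Ioo 0 L)) {φ : ℝ → ℝ}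
    (hφ : IsTest L φ) : Integrable (fun s ↦ φ s • v s) (volume.restrict (Ioo 0 L)) := by
  have h1 : IntegrableOn (fun s ↦ φ s • v s) (tsupport φ) volume :=
    (hv.integrableOn_compact_subset hφ.tsupport_subset hφ.hasCompactSupport).continuousOn_smul
      hφ.contDiff.continuous.continuousOn hφ.hasCompactSupport
  refine h1.of_forall_sdiff_eq_zero measurableSet_Ioo fun x hx ↦ ?_
  rw [image_eq_zero_of_notMem_tsupport hx.2, zero_smul]

theorem integral_Ioo_congr_ae (φ : ℝ → ℝ) (h : ∀ᵐ s ∂volume.restrict (Ioo 0 L), u s = u' s) :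
    ∫ s in Ioo 0 L, φ s • u s = ∫ s in Ioo 0 L, φ s • u' s :=
  integral_congr_ae (h.mono fun s hs ↦ by simp only [hs])

/-- Weak derivatives are unique up to null sets. -/
theorem IsWeakDeriv.ae_eq (h : IsWeakDeriv L u v) (h' : IsWeakDeriv L u' v')
    (hu : ∀ᵐ s ∂volume.restrict (Ioo 0 L), u s = u' s) :
    ∀ᵐ s ∂volume.restrict (Ioo 0 L), v s = v' s := by
  have h0 := isOpen_Ioo.ae_eq_zero_of_integral_contDiff_smul_eq_zero (U := Ioo 0 L)
    (f := fun s ↦ v s - v' s) (μ := volume)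
    (h.locallyIntegrable_right.sub h'.locallyIntegrable_right) (by
      intro φ h1 h2 h3
      have hφ : IsTest L φ := ⟨h1, h2, h3⟩
      rw [← setIntegral_eq_integral_of_forall_compl_eq_zero (s := Ioo 0 L)
        fun x hx ↦ by rw [hφ.eq_zero hx, zero_smul]]
      simp only [smul_sub]
      rw [integral_sub (hφ.integrable_smul h.locallyIntegrable_right)
        (hφ.integrable_smul h'.locallyIntegrable_right), sub_eq_zero, ← neg_inj,
        ← h.integral_eq φ h1 h2 h3, ← h'.integral_eq φ h1 h2 h3]
      exact integral_Ioo_congr_ae _ hu)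
  rw [ae_restrict_iff' measurableSet_Ioo]
  filter_upwards [h0] with s hs hsI using sub_eq_zero.1 (hs hsI)

theorem IsWeakDeriv.congr_left (h : IsWeakDeriv L u v)
    (hu : ∀ᵐ s ∂volume.restrict (Ioo 0 L), u' s = u s)
    (hi : LocallyIntegrableOn u' (Ioo 0 L)) : IsWeakDeriv L u' v :=
  ⟨hi, h.locallyIntegrable_right, fun φ h1 h2 h3 ↦ by
    rw [integral_Ioo_congr_ae _ hu, h.integral_eq φ h1 h2 h3]⟩

theorem IsWeakDeriv.isWeakDeriv_weakDeriv (h : IsWeakDeriv L u v) :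
    IsWeakDeriv L u (weakDeriv L u) := by
  have hex : ∃ v, IsWeakDeriv L u v := ⟨v, h⟩
  rw [weakDeriv, dif_pos hex]
  exact hex.choose_spec

/-- Uniqueness, applied twice, frees the energy from the representatives chosen by `weakDeriv`. -/
theorem bendingEnergy_eq {γ g h : ℝ → E3} (hg : IsWeakDeriv L γ g) (hh : IsWeakDeriv L g h) :
    bendingEnergy L γ = ∫ s in Ioo 0 L, ‖h s‖ ^ 2 := by
  have h1 := hg.isWeakDeriv_weakDeriv
  have h2 := h1.ae_eq hg (Filter.Eventually.of_forall fun _ ↦ rfl)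
  have h3 := (hh.congr_left h2 h1.locallyIntegrable_right).isWeakDeriv_weakDeriv
  have h4 := h3.ae_eq hh h2
  exact integral_congr_ae (h4.mono fun s hs ↦ by simp only [hs])

theorem IsPrimitive.isWeakDeriv (hL : 0 ≤ L) (h : IsPrimitive L u v) : IsWeakDeriv L u v := by
  refine (h.integratesByParts hL).isWeakDeriv ?_ ?_
  · exact IntegrableOn.locallyIntegrableOn
      (((h.continuousOn hL).integrableOn_Icc).mono_set Ioo_subset_Icc_self)
  · exact IntegrableOn.locallyIntegrableOn (h.intervalIntegrable.integrable_Ioo hL)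

end Sobolev

/-! ### Correspondence between clamped curves and indicatrices. -/

section Curves

variable {L : ℝ} {P₀ P₁ V₀ V₁ : E3}

/-- The second weak derivative is also a weak derivative of the continuous tangent. The tangent
agrees almost everywhere with a primitive of it, hence everywhere by continuity. -/
theorem exists_isIndicatrix_of_mem_clampedCurves (hL : 0 < L) {γ : ℝ → E3}
    (hγ : γ ∈ clampedCurves L P₀ P₁ V₀ V₁) :
    IsPrimitive L γ (tangent L γ) ∧ ∃ k, IsIndicatrix L (P₁ - P₀) V₀ V₁ (tangent L γ) k ∧
      bendingEnergy L γ = ∫ s in Ioo 0 L, ‖k s‖ ^ 2 := by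
  obtain ⟨hW, h0, hLP, hV0, hV1⟩ := hγ
  have hu := uniqueDiffOn_Icc hL
  have hc : ContinuousOn (tangent L γ) (Icc 0 L) :=
    hW.contDiffOn.continuousOn_derivWithin hu le_rfl
  have hp : IsPrimitive L γ (tangent L γ) := isPrimitive_of_continuousOn hL.le hc fun s hs ↦
    (hW.contDiffOn.differentiableOn one_ne_zero s hs).hasDerivWithinAt
  refine ⟨hp, ?_⟩
  obtain ⟨-, g, h, hg, hh, -, hh2⟩ := hW.memW22
  have hTg := (hp.isWeakDeriv hL.le).ae_eq hg (Filter.Eventually.of_forall fun _ ↦ rfl)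
  have hTi := hc.memLp_Ioo (p := 1)
  have hTh : IsWeakDeriv L (tangent L γ) h := hh.congr_left hTg
    (IntegrableOn.locallyIntegrableOn (memLp_one_iff_integrable.1 hTi))
  have hhi := hh2.intervalIntegrable hL.le
  obtain ⟨c, hcT⟩ := hTh.integratesByParts.ae_eq_const_add_integral hL
    (memLp_one_iff_integrable.1 hTi) hhi
  have hprim : IsPrimitive L (fun s ↦ c + ∫ t in 0..s, h t) h := ⟨hhi, fun s _ ↦ by simp⟩
  have heq := eqOn_Icc_of_ae_eq hL hc (hprim.continuousOn hL.le) hcT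
  refine ⟨h, ⟨hh2, ⟨hhi, fun s hs ↦ ?_⟩, hW.norm_tangent, hV0, hV1, ?_⟩, bendingEnergy_eq hg hh⟩
  · rw [heq hs, heq ⟨le_rfl, hL.le⟩]
    simp
  · rw [← hLP, ← h0, hp.eq_add_integral L ⟨hL.le, le_rfl⟩]
    simp

/-- Integrating the tangent from `P₀` recovers a curve, so minimality among curves passes to
minimality among indicatrices. -/
theorem IsIndicatrix.exists_mem_clampedCurves (hL : 0 < L) {T k : ℝ → E3}
    (h : IsIndicatrix L (P₁ - P₀) V₀ V₁ T k) :
    ∃ γ ∈ clampedCurves L P₀ P₁ V₀ V₁, bendingEnergy L γ = ∫ s in Ioo 0 L, ‖k s‖ ^ 2 := by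
  have hc := h.isPrimitive.continuousOn hL.le
  have hu := uniqueDiffOn_Icc hL
  set γ : ℝ → E3 := fun s ↦ P₀ + ∫ t in 0..s, T t with hγ
  have hd : ∀ s ∈ Icc 0 L, HasDerivWithinAt γ (T s) (Icc 0 L) s := fun s hs ↦
    (hasDerivWithinAt_integral_Icc hc hs).const_add P₀
  have ht : ∀ s ∈ Icc 0 L, tangent L γ s = T s := fun s hs ↦ (hd s hs).derivWithin (hu s hs)
  have hp : IsPrimitive L γ T := isPrimitive_of_continuousOn hL.le hc hd
  have hw1 := hp.isWeakDeriv hL.le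
  have hw2 := h.isPrimitive.isWeakDeriv hL.le
  have h0m : (0 : ℝ) ∈ Icc 0 L := ⟨le_rfl, hL.le⟩
  have hLm : L ∈ Icc 0 L := ⟨hL.le, le_rfl⟩
  refine ⟨γ, ⟨⟨⟨(hp.continuousOn hL.le).memLp_Ioo, T, k, hw1, hw2, hc.memLp_Ioo, h.memLp⟩, ?_, ?_⟩,
    ?_, ?_, ?_, ?_⟩, bendingEnergy_eq hw1 hw2⟩
  · rw [show (1 : WithTop ℕ∞) = 0 + 1 by simp, contDiffOn_succ_iff_derivWithin hu]
    refine ⟨fun s hs ↦ (hd s hs).differentiableWithinAt, by simp, ?_⟩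
    exact contDiffOn_zero.2 (hc.congr ht)
  · intro s hs
    rw [ht s hs, h.norm_eq_one s hs]
  · simp [hγ]
  · simp [hγ, h.integral_eq]
  · rw [ht 0 h0m, h.left]
  · rw [ht L hLm, h.right]

end Curves

/-! ### Differentiation under the integral sign. -/

section ParametricIntegral

variable {Q F G : Type*} [NormedAddCommGroup Q] [NormedSpace ℝ Q] [ProperSpace Q]
  [NormedAddCommGroup F] [NormedSpace ℝ F] [NormedAddCommGroup G] [NormedSpace ℝ G]

/-- Integrals of a `C¹` family against an integrable weight are strictly differentiable in the
parameter, and the derivative is computed under the integral. -/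
theorem exists_hasStrictFDerivAt_integral {L : ℝ} {ℓ : ℝ → F →L[ℝ] G}
    (hℓ : Integrable ℓ (volume.restrict (Ioo 0 L))) {M : Q × ℝ → F} (hM : ContDiff ℝ 1 M) :
    ∃ D : Q →L[ℝ] G, HasStrictFDerivAt (fun a ↦ ∫ s in Ioo 0 L, ℓ s (M (a, s))) D 0 ∧
      ∀ (h : Q) (M' : ℝ → F), (∀ s, HasDerivAt (fun t : ℝ ↦ M (t • h, s)) (M' s) 0) →
        D h = ∫ s in Ioo 0 L, ℓ s (M' s) := by
  set μ := volume.restrict (Ioo 0 L) with hμ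
  set D : Q → ℝ → Q →L[ℝ] F := fun a s ↦
    (fderiv ℝ M (a, s)).comp (ContinuousLinearMap.inl ℝ Q ℝ) with hD
  have hDc : Continuous fun p : Q × ℝ ↦ D p.1 p.2 :=
    (hM.continuous_fderiv one_ne_zero).clm_comp continuous_const
  have hDd : ∀ a s, HasFDerivAt (fun a ↦ M (a, s)) (D a s) a := fun a s ↦
    ((hM.differentiable one_ne_zero (a, s)).hasFDerivAt).comp a (hasFDerivAt_prodMk_left a s)
  -- Compactness bounds the parameter derivative uniformly on the unit ball, so a multiple of `‖ℓ
  -- s‖` dominates there. Continuity of the resulting derivative at `0` then gives strictness.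
  obtain ⟨C, hC⟩ := ((isCompact_closedBall (0 : Q) 1).prod
    (isCompact_Icc (a := (0 : ℝ)) (b := L))).exists_bound_of_continuousOn hDc.continuousOn
  obtain ⟨C₀, hC₀⟩ := ((isCompact_closedBall (0 : Q) 1).prod
    (isCompact_Icc (a := (0 : ℝ)) (b := L))).exists_bound_of_continuousOn
      hM.continuous.continuousOn
  have hsec : ∀ a : Q, Continuous fun s : ℝ ↦ (a, s) := fun a ↦ by fun_prop
  have hmeas : ∀ a, AEStronglyMeasurable (fun s ↦ ℓ s (M (a, s))) μ := fun a ↦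
    (ContinuousLinearMap.apply ℝ G).flip.aestronglyMeasurable_comp₂ hℓ.1
      (hM.continuous.comp (hsec a)).aestronglyMeasurable
  have hmeas' : ∀ a, AEStronglyMeasurable (fun s ↦ (ℓ s).comp (D a s)) μ := fun a ↦
    (ContinuousLinearMap.compL ℝ Q F G).aestronglyMeasurable_comp₂ hℓ.1
      (hDc.comp (hsec a)).aestronglyMeasurable
  have hbound : ∀ᵐ s ∂μ, ∀ a ∈ Metric.ball (0 : Q) 1, ‖(ℓ s).comp (D a s)‖ ≤ C * ‖ℓ s‖ := by
    filter_upwards [ae_restrict_mem measurableSet_Ioo] with s hs a ha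
    rw [mul_comm]
    exact ((ℓ s).opNorm_comp_le _).trans (mul_le_mul_of_nonneg_left
      (hC (a, s) ⟨Metric.ball_subset_closedBall ha, Ioo_subset_Icc_self hs⟩) (norm_nonneg _))
  have hint : ∀ a ∈ Metric.ball (0 : Q) 1, Integrable (fun s ↦ ℓ s (M (a, s))) μ := by
    intro a ha
    refine Integrable.mono' (hℓ.norm.const_mul C₀) (hmeas a) ?_
    filter_upwards [ae_restrict_mem measurableSet_Ioo] with s hs
    rw [mul_comm]
    exact ((ℓ s).le_opNorm _).trans (mul_le_mul_of_nonneg_left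
      (hC₀ (a, s) ⟨Metric.ball_subset_closedBall ha, Ioo_subset_Icc_self hs⟩) (norm_nonneg _))
  have hdiff : ∀ a ∈ Metric.ball (0 : Q) 1, HasFDerivAt (fun a ↦ ∫ s, ℓ s (M (a, s)) ∂μ)
      (∫ s, (ℓ s).comp (D a s) ∂μ) a := fun a ha ↦
    hasFDerivAt_integral_of_dominated_of_fderiv_le (Metric.isOpen_ball.mem_nhds ha)
      (Filter.Eventually.of_forall hmeas) (hint a ha) (hmeas' a) hbound (hℓ.norm.const_mul C)
      (Filter.Eventually.of_forall fun s a _ ↦ (ℓ s).hasFDerivAt.comp a (hDd a s))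
  have hcont : ContinuousAt (fun a ↦ ∫ s, (ℓ s).comp (D a s) ∂μ) 0 := by
    refine continuousAt_of_dominated (Filter.Eventually.of_forall hmeas') ?_
      (hℓ.norm.const_mul C) (Filter.Eventually.of_forall fun s ↦ ?_)
    · filter_upwards [Metric.ball_mem_nhds (0 : Q) one_pos] with a ha
      filter_upwards [hbound] with s hs using hs a ha
    · have : Continuous fun a : Q ↦ (ℓ s).comp (D a s) :=
        continuous_const.clm_comp (hDc.comp (by fun_prop : Continuous fun a : Q ↦ (a, s)))
      exact this.continuousAt
  refine ⟨∫ s, (ℓ s).comp (D 0 s) ∂μ, hasStrictFDerivAt_of_hasFDerivAt_of_continuousAt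
    (Filter.mem_of_superset (Metric.ball_mem_nhds (0 : Q) one_pos) hdiff) hcont, ?_⟩
  intro h M' hM'
  have hi : Integrable (fun s ↦ (ℓ s).comp (D 0 s)) μ :=
    Integrable.mono' (hℓ.norm.const_mul C) (hmeas' 0) (hbound.mono fun s hs ↦ hs 0 (by simp))
  rw [ContinuousLinearMap.integral_apply hi]
  refine integral_congr_ae (Filter.Eventually.of_forall fun s ↦ ?_)
  have h1 : HasDerivAt (fun t : ℝ ↦ t • h) h 0 := by
    simpa using (hasDerivAt_id (0 : ℝ)).smul_const h
  have h2 : HasDerivAt (fun t : ℝ ↦ M (t • h, s)) (D 0 s h) 0 :=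
    HasFDerivAt.comp_hasDerivAt_of_eq (f := fun t : ℝ ↦ t • h) (0 : ℝ) (hDd 0 s) h1 (by simp)
  exact congrArg (ℓ s) (h2.unique (hM' s))

end ParametricIntegral

/-! ### Exponentials of skew operators. -/

section Rotations

open scoped ContDiff

variable {E : Type*} [NormedAddCommGroup E] [InnerProductSpace ℝ E] [CompleteSpace E]

theorem contDiff_exp_clm : ContDiff ℝ ∞ (NormedSpace.exp : (E →L[ℝ] E) → (E →L[ℝ] E)) :=
  AnalyticOnNhd.contDiff fun x _ ↦ NormedSpace.exp_analytic (𝕂 := ℝ) x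

theorem exp_mul_exp_neg_clm (A : (E →L[ℝ] E)) : NormedSpace.exp A * NormedSpace.exp (-A) = 1 := by
  let +nondep : NormedAlgebra ℚ (E →L[ℝ] E) := .restrictScalars ℚ ℝ (E →L[ℝ] E)
  rw [← NormedSpace.exp_add_of_commute (Commute.refl A).neg_right, add_neg_cancel,
    NormedSpace.exp_zero]

/-- The exponential of a skew operator preserves norms. -/
theorem norm_exp_apply_of_inner_eq_zero {A : E →L[ℝ] E} (hA : ∀ x, inner ℝ x (A x) = 0)
    (x : E) : ‖NormedSpace.exp A x‖ = ‖x‖ := by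
  have hd : ∀ t : ℝ, HasDerivAt (fun t : ℝ ↦ ‖NormedSpace.exp (t • A) x‖ ^ 2) 0 t := fun t ↦ by
    have h1 := hasDerivAt_exp_smul_const' (𝕂 := ℝ) A t
    have h2 := (h1.clm_apply (hasDerivAt_const t x)).norm_sq
    have h3 : (2 : ℝ) * inner ℝ (NormedSpace.exp (t • A) x)
        ((A * NormedSpace.exp (t • A)) x + NormedSpace.exp (t • A) 0) = 0 := by
      rw [map_zero, add_zero, mul_apply_eq_comp, hA, mul_zero]
    rwa [h3] at h2
  have h := is_const_of_deriv_eq_zero (fun t ↦ (hd t).differentiableAt) (fun t ↦ (hd t).deriv) 1 0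
  simp only [one_smul, zero_smul, NormedSpace.exp_zero, one_apply_eq_self] at h
  exact (sq_eq_sq₀ (norm_nonneg _) (norm_nonneg _)).1 h

/-- The logarithmic derivative `exp (-A) · D exp (A) [B]` of the exponential. -/
noncomputable def expLogDeriv (p : (E →L[ℝ] E) × (E →L[ℝ] E)) : (E →L[ℝ] E) :=
  NormedSpace.exp (-p.1) * fderiv ℝ (NormedSpace.exp : (E →L[ℝ] E) → (E →L[ℝ] E)) p.1 p.2

theorem contDiff_expLogDeriv : ContDiff ℝ ∞ (expLogDeriv (E := E)) := by
  have h1 : ContDiff ℝ ∞ fun p : (E →L[ℝ] E) × (E →L[ℝ] E) ↦ NormedSpace.exp (-p.1) :=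
    contDiff_exp_clm.comp contDiff_fst.neg
  have h2 : ContDiff ℝ ∞ (fderiv ℝ (NormedSpace.exp : (E →L[ℝ] E) → (E →L[ℝ] E))) :=
    contDiff_exp_clm.fderiv_right (by simp)
  exact h1.clm_comp ((h2.comp contDiff_fst).clm_apply contDiff_snd)

/-- Factoring out the rotation R gives the rotated indicatrix the curvature vector R (k + Ω T), Ω
the angular velocity, so that R drops out of the energy. -/
theorem exp_mul_expLogDeriv (A B : (E →L[ℝ] E)) :
    NormedSpace.exp A * expLogDeriv (A, B) =
      fderiv ℝ (NormedSpace.exp : (E →L[ℝ] E) → (E →L[ℝ] E)) A B := by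
  rw [expLogDeriv, ← mul_assoc, exp_mul_exp_neg_clm, one_mul]

theorem expLogDeriv_zero_left (B : (E →L[ℝ] E)) : expLogDeriv (0, B) = B := by
  have h : HasFDerivAt (NormedSpace.exp : (E →L[ℝ] E) → (E →L[ℝ] E)) (1 : (E →L[ℝ] E) →L[ℝ] (E →L[ℝ] E)) 0 :=
    hasFDerivAt_exp_zero
  rw [expLogDeriv, h.fderiv]
  simp [NormedSpace.exp_zero]

omit [CompleteSpace E] in
theorem expLogDeriv_smul_right (t : ℝ) (A B : (E →L[ℝ] E)) :
    expLogDeriv (A, t • B) = t • expLogDeriv (A, B) := by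
  simp [expLogDeriv]

theorem hasDerivAt_exp_smul_zero (A : (E →L[ℝ] E)) :
    HasDerivAt (fun t : ℝ ↦ NormedSpace.exp (t • A)) A 0 := by
  simpa [NormedSpace.exp_zero] using hasDerivAt_exp_smul_const (𝕂 := ℝ) A (0 : ℝ)

/-- By linearity in the second slot the function is t g(t) with g(t) = `expLogDeriv (t • A, B)`, and
its derivative at 0 is g(0) = B. -/
theorem hasDerivAt_expLogDeriv_smul_zero (A B : (E →L[ℝ] E)) :
    HasDerivAt (fun t : ℝ ↦ expLogDeriv (t • A, t • B)) B 0 := by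
  have hs : ContDiff ℝ ∞ fun t : ℝ ↦ expLogDeriv (t • A, B) :=
    contDiff_expLogDeriv.comp (ContDiff.prodMk (f := fun t : ℝ ↦ t • A)
      (contDiff_id.smul contDiff_const) contDiff_const)
  have h := (hasDerivAt_id (0 : ℝ)).smul (hs.differentiable (by simp) 0).hasDerivAt
  simp only [id, zero_smul, one_smul, zero_add, expLogDeriv_zero_left] at h
  refine h.congr_of_eventuallyEq (Filter.Eventually.of_forall fun t ↦ ?_)
  simp [expLogDeriv_smul_right]

theorem contDiff_star_clm : ContDiff ℝ ∞ (star : (E →L[ℝ] E) → (E →L[ℝ] E)) :=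
  (starL' ℝ (A := (E →L[ℝ] E))).contDiff

/-- The part of the energy that is quadratic in the angular velocity does not enter the first
variation, since the angular velocity vanishes at t = 0. -/
theorem hasDerivAt_star_mul_expLogDeriv_smul_zero (A B : (E →L[ℝ] E)) :
    HasDerivAt (fun t : ℝ ↦ star (expLogDeriv (t • A, t • B)) * expLogDeriv (t • A, t • B))
      0 0 := by
  have h1 := hasDerivAt_expLogDeriv_smul_zero A B
  have h2 := ((starL' ℝ (A := (E →L[ℝ] E))).hasFDerivAt).comp_hasDerivAt (0 : ℝ) h1
  have h0 : expLogDeriv ((0 : ℝ) • A, (0 : ℝ) • B) = 0 := by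
    rw [expLogDeriv_smul_right, zero_smul]
  have h3 := h2.mul h1
  simp only [Function.comp_apply, h0, mul_zero, map_zero, zero_mul, add_zero] at h3
  exact h3

/-- Each parameter-dependent term is linear in an operator (`A` or `star A * A`), the form needed to
differentiate the energy under the integral. -/
theorem norm_add_apply_sq (x y : E) (A : (E →L[ℝ] E)) :
    ‖x + A y‖ ^ 2 = ‖x‖ ^ 2 + inner ℝ ((2 : ℝ) • x) (A y) + inner ℝ y ((star A * A) y) := by
  rw [norm_add_sq_real, real_inner_smul_left]
  congr 1
  rw [ContinuousLinearMap.star_eq_adjoint, mul_apply_eq_comp,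
    ContinuousLinearMap.adjoint_inner_right, real_inner_self_eq_norm_sq]

end Rotations

/-! ### Parametric integrals weighted by the tangent and the curvature. -/

section Weights

variable {Q F E G : Type*} [NormedAddCommGroup Q] [NormedSpace ℝ Q] [ProperSpace Q]
  [NormedAddCommGroup F] [NormedSpace ℝ F] [NormedAddCommGroup E] [InnerProductSpace ℝ E]
  {L : ℝ} {T w : ℝ → E}

theorem exists_hasStrictFDerivAt_integral_apply (hT : ContinuousOn T (Icc 0 L))
    (ev : F →L[ℝ] E →L[ℝ] E) {M : Q × ℝ → F} (hM : ContDiff ℝ 1 M) :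
    ∃ D : Q →L[ℝ] E, HasStrictFDerivAt (fun a ↦ ∫ s in Ioo 0 L, ev (M (a, s)) (T s)) D 0 ∧
      ∀ (h : Q) (M' : ℝ → F), (∀ s, HasDerivAt (fun t : ℝ ↦ M (t • h, s)) (M' s) 0) →
        D h = ∫ s in Ioo 0 L, ev (M' s) (T s) := by
  have h : ContinuousOn (fun s ↦ ev.flip (T s)) (Icc 0 L) :=
    ev.flip.continuous.comp_continuousOn hT
  exact exists_hasStrictFDerivAt_integral (h.integrableOn_Icc.mono_set Ioo_subset_Icc_self) hM

/-- Used with `w` equal to 2k, for which only integrability is at hand, and to T: the linear and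
quadratic parts of the energy. -/
theorem exists_hasStrictFDerivAt_integral_inner (hT : ContinuousOn T (Icc 0 L))
    (hw : Integrable w (volume.restrict (Ioo 0 L)))
    (ev : F →L[ℝ] E →L[ℝ] E) {M : Q × ℝ → F} (hM : ContDiff ℝ 1 M) :
    ∃ D : Q →L[ℝ] ℝ,
      HasStrictFDerivAt (fun a ↦ ∫ s in Ioo 0 L, inner ℝ (w s) (ev (M (a, s)) (T s))) D 0 ∧
      ∀ (h : Q) (M' : ℝ → F), (∀ s, HasDerivAt (fun t : ℝ ↦ M (t • h, s)) (M' s) 0) →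
        D h = ∫ s in Ioo 0 L, inner ℝ (w s) (ev (M' s) (T s)) := by
  obtain ⟨C, hC⟩ := isCompact_Icc.exists_bound_of_continuousOn
    (ev.flip.continuous.comp_continuousOn hT)
  have hTm : AEStronglyMeasurable T (volume.restrict (Ioo 0 L)) :=
    (hT.mono Ioo_subset_Icc_self).aestronglyMeasurable measurableSet_Ioo
  have hi : Integrable (fun s ↦ (innerSL ℝ (w s)).comp (ev.flip (T s)))
      (volume.restrict (Ioo 0 L)) := by
    refine Integrable.mono' (hw.norm.const_mul C) ?_ ?_
    · exact (ContinuousLinearMap.compL ℝ F E ℝ).aestronglyMeasurable_comp₂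
        ((innerSL ℝ).continuous.comp_aestronglyMeasurable hw.1)
        (ev.flip.continuous.comp_aestronglyMeasurable hTm)
    · filter_upwards [ae_restrict_mem measurableSet_Ioo] with s hs
      refine (ContinuousLinearMap.opNorm_comp_le _ _).trans ?_
      rw [innerSL_apply_norm, mul_comm]
      exact mul_le_mul_of_nonneg_right (hC s (Ioo_subset_Icc_self hs)) (norm_nonneg _)
  exact exists_hasStrictFDerivAt_integral hi hM

end Weights

/-! ### Variations by fields of rotations and the multiplier rule. -/

section Variations

open scoped ContDiff

variable {E : Type*} [NormedAddCommGroup E] [InnerProductSpace ℝ E]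
  {L : ℝ} {P V₀ V₁ : E} {T k w : ℝ → E}

/-- Smooth fields of skew operators on `[0, L]` which vanish at the endpoints. -/
structure IsSkewField (L : ℝ) (X : ℝ → E →L[ℝ] E) : Prop where
  contDiff : ContDiff ℝ ∞ X
  inner_eq_zero : ∀ s x, inner ℝ x (X s x) = 0
  left : X 0 = 0
  right : X L = 0

/-- The linear combination `∑ i, a i • X i s`, as a function of `(a, s)`. -/
noncomputable def fieldSum {ι : Type*} [Fintype ι] (X : ι → ℝ → E →L[ℝ] E) (p : (ι → ℝ) × ℝ) :
    E →L[ℝ] E :=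
  ∑ i, p.1 i • X i p.2

section FieldSum

variable {ι : Type*} [Fintype ι] {X : ι → ℝ → E →L[ℝ] E}

theorem contDiff_fieldSum (hX : ∀ i, ContDiff ℝ ∞ (X i)) : ContDiff ℝ ∞ (fieldSum X) :=
  ContDiff.sum fun i _ ↦ ((contDiff_apply ℝ ℝ i).comp contDiff_fst).smul
    ((hX i).comp contDiff_snd)

theorem hasDerivAt_fieldSum (hX : ∀ i, ContDiff ℝ ∞ (X i)) (a : ι → ℝ) (s : ℝ) :
    HasDerivAt (fun s ↦ fieldSum X (a, s)) (fieldSum (fun i ↦ deriv (X i)) (a, s)) s :=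
  HasDerivAt.fun_sum fun i _ ↦
    (((hX i).differentiable (by simp) s).hasDerivAt).const_smul (a i)

theorem fieldSum_smul_single [DecidableEq ι] (t : ℝ) (i : ι) (s : ℝ) :
    fieldSum X (t • Pi.single i 1, s) = t • X i s := by
  simp [fieldSum, Pi.single_apply]

theorem fieldSum_zero (s : ℝ) : fieldSum X (0, s) = 0 := by
  simp [fieldSum]

theorem inner_fieldSum_eq_zero (hX : ∀ i, IsSkewField L (X i)) (a : ι → ℝ) (s : ℝ) (x : E) :
    inner ℝ x (fieldSum X (a, s) x) = 0 := by
  simp [fieldSum, inner_sum, inner_smul_right, (hX _).inner_eq_zero]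

end FieldSum

theorem integrable_inner_of_continuousOn (hw : Integrable w (volume.restrict (Ioo 0 L)))
    {c : ℝ → E} (hc : ContinuousOn c (Icc 0 L)) :
    Integrable (fun s ↦ inner ℝ (w s) (c s)) (volume.restrict (Ioo 0 L)) := by
  obtain ⟨C, hC⟩ := isCompact_Icc.exists_bound_of_continuousOn hc
  refine Integrable.mono' (hw.norm.const_mul C) (hw.1.inner
    ((hc.mono Ioo_subset_Icc_self).aestronglyMeasurable measurableSet_Ioo)) ?_
  filter_upwards [ae_restrict_mem measurableSet_Ioo] with s hs
  rw [mul_comm]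
  exact (norm_inner_le_norm _ _).trans
    (mul_le_mul_of_nonneg_left (hC s (Ioo_subset_Icc_self hs)) (norm_nonneg _))

variable [CompleteSpace E]

section Rotated

variable {ι : Type*} [Fintype ι]

/-- The rotation `exp (∑ i, a i • X i s)`. -/
noncomputable def fieldRotation (X : ι → ℝ → E →L[ℝ] E) (p : (ι → ℝ) × ℝ) : E →L[ℝ] E :=
  NormedSpace.exp (fieldSum X p)

/-- The angular velocity of `fieldRotation`, in the moving frame. -/
noncomputable def angularVelocity (X : ι → ℝ → E →L[ℝ] E) (p : (ι → ℝ) × ℝ) : E →L[ℝ] E :=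
  expLogDeriv (fieldSum X p, fieldSum (fun i ↦ deriv (X i)) p)

variable {X : ι → ℝ → E →L[ℝ] E}

theorem contDiff_fieldRotation (hX : ∀ i, IsSkewField L (X i)) : ContDiff ℝ ∞ (fieldRotation X) :=
  contDiff_exp_clm.comp (contDiff_fieldSum fun i ↦ (hX i).contDiff)

theorem contDiff_angularVelocity (hX : ∀ i, IsSkewField L (X i)) :
    ContDiff ℝ ∞ (angularVelocity X) :=
  contDiff_expLogDeriv.comp ((contDiff_fieldSum fun i ↦ (hX i).contDiff).prodMk
    (contDiff_fieldSum fun i ↦ (contDiff_infty_iff_deriv.1 (hX i).contDiff).2))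

theorem deriv_fieldRotation (hX : ∀ i, IsSkewField L (X i)) (a : ι → ℝ) (s : ℝ) :
    deriv (fun s ↦ fieldRotation X (a, s)) s = fieldRotation X (a, s) * angularVelocity X (a, s) := by
  rw [fieldRotation, angularVelocity, exp_mul_expLogDeriv]
  exact ((contDiff_exp_clm.differentiable (by simp) _).hasFDerivAt.comp_hasDerivAt s
    (hasDerivAt_fieldSum (fun i ↦ (hX i).contDiff) a s)).deriv

theorem norm_fieldRotation_apply (hX : ∀ i, IsSkewField L (X i)) (p : (ι → ℝ) × ℝ) (x : E) :
    ‖fieldRotation X p x‖ = ‖x‖ :=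
  norm_exp_apply_of_inner_eq_zero (inner_fieldSum_eq_zero hX p.1 p.2) x

theorem continuousOn_angularVelocity_apply (hX : ∀ i, IsSkewField L (X i))
    (hT : ContinuousOn T (Icc 0 L)) (a : ι → ℝ) :
    ContinuousOn (fun s ↦ angularVelocity X (a, s) (T s)) (Icc 0 L) := by
  have hc : Continuous fun s : ℝ ↦ angularVelocity X (a, s) :=
    (contDiff_angularVelocity hX).continuous.comp (by fun_prop)
  exact hc.continuousOn.clm_apply hT

/-- Rotating the tangent indicatrix by a field of rotations fixing both ends. -/
theorem IsIndicatrix.rotate (hL : 0 ≤ L) (h : IsIndicatrix L P V₀ V₁ T k)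
    (hX : ∀ i, IsSkewField L (X i)) (a : ι → ℝ) :
    IsIndicatrix L (∫ s in Ioo 0 L, fieldRotation X (a, s) (T s)) V₀ V₁
      (fun s ↦ fieldRotation X (a, s) (T s))
      (fun s ↦ fieldRotation X (a, s) (k s + angularVelocity X (a, s) (T s))) := by
  have hc : ContDiff ℝ 1 fun s ↦ fieldRotation X (a, s) :=
    ((contDiff_fieldRotation hX).comp (contDiff_const.prodMk contDiff_id)).of_le
      (by exact_mod_cast le_top)
  have hp : IsPrimitive L (fun s ↦ fieldRotation X (a, s) (T s))
      (fun s ↦ fieldRotation X (a, s) (k s + angularVelocity X (a, s) (T s))) := by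
    convert! h.isPrimitive.clm_apply hL hc using 2 with s
    rw [deriv_fieldRotation hX, mul_apply_eq_comp, map_add, add_comm]
  have hV := continuousOn_angularVelocity_apply hX (h.isPrimitive.continuousOn hL) a
  have hid : ∀ s, (∀ i, X i s = 0) → fieldRotation X (a, s) = 1 := fun s hs ↦ by
    rw [fieldRotation, fieldSum]
    simp [hs, NormedSpace.exp_zero]
  refine ⟨?_, hp, fun s hs ↦ ?_, ?_, ?_, (integral_Ioo_eq_intervalIntegral hL _).symm⟩
  · refine MemLp.of_le (h.memLp.add (hV.memLp_Ioo)) (hp.intervalIntegrable.integrable_Ioo hL).1 ?_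
    exact Filter.Eventually.of_forall fun s ↦ (norm_fieldRotation_apply hX _ _).le
  · rw [norm_fieldRotation_apply hX, h.norm_eq_one s hs]
  · simp [hid 0 fun i ↦ (hX i).left, h.left]
  · simp [hid L fun i ↦ (hX i).right, h.right]

/-- The Lagrange multiplier rule for variations by a finite family of fields. -/
theorem IsIndicatrix.exists_multiplier_of_fintype (hL : 0 ≤ L) (h : IsIndicatrix L P V₀ V₁ T k)
    (hmin : ∀ T' k', IsIndicatrix L P V₀ V₁ T' k' →
      ∫ s in Ioo 0 L, ‖k s‖ ^ 2 ≤ ∫ s in Ioo 0 L, ‖k' s‖ ^ 2)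
    (hX : ∀ i, IsSkewField L (X i)) :
    ∃ (Λ : Module.Dual ℝ E) (Λ₀ : ℝ), (Λ, Λ₀) ≠ 0 ∧ ∀ i,
      Λ (∫ s in Ioo 0 L, X i s (T s)) +
        Λ₀ * (2 * ∫ s in Ioo 0 L, inner ℝ (k s) (deriv (X i) s (T s))) = 0 := by
  classical
  have hT := h.isPrimitive.continuousOn hL
  have hki := h.isPrimitive.intervalIntegrable.integrable_Ioo hL
  have hTi : Integrable T (volume.restrict (Ioo 0 L)) :=
    hT.integrableOn_Icc.mono_set Ioo_subset_Icc_self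
  have hR1 : ContDiff ℝ 1 (fieldRotation X) :=
    (contDiff_fieldRotation hX).of_le (by exact_mod_cast le_top)
  have hH := contDiff_angularVelocity hX
  have hH1 : ContDiff ℝ 1 (angularVelocity X) := hH.of_le (by exact_mod_cast le_top)
  have hHH1 : ContDiff ℝ 1 fun p ↦ star (angularVelocity X p) * angularVelocity X p :=
    ((contDiff_star_clm.comp hH).clm_comp hH).of_le (by exact_mod_cast le_top)
  obtain ⟨D, hD, hD'⟩ := exists_hasStrictFDerivAt_integral_apply hT
    (ContinuousLinearMap.id ℝ (E →L[ℝ] E)) hR1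
  have h2k : Integrable (fun s ↦ (2 : ℝ) • k s) (volume.restrict (Ioo 0 L)) := hki.fun_smul 2
  obtain ⟨D₁, hD₁, hD₁'⟩ := exists_hasStrictFDerivAt_integral_inner hT h2k
    (ContinuousLinearMap.id ℝ (E →L[ℝ] E)) hH1
  obtain ⟨D₂, hD₂, hD₂'⟩ := exists_hasStrictFDerivAt_integral_inner hT hTi
    (ContinuousLinearMap.id ℝ (E →L[ℝ] E)) hHH1
  have henergy : ∀ a, ∫ s in Ioo 0 L, ‖k s + angularVelocity X (a, s) (T s)‖ ^ 2 =
      (∫ s in Ioo 0 L, ‖k s‖ ^ 2) +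
        ((∫ s in Ioo 0 L, inner ℝ ((2 : ℝ) • k s) (angularVelocity X (a, s) (T s))) +
        ∫ s in Ioo 0 L, inner ℝ (T s)
          ((star (angularVelocity X (a, s)) * angularVelocity X (a, s)) (T s))) := by
    intro a
    have hV := continuousOn_angularVelocity_apply hX hT a
    have hc : Continuous fun s : ℝ ↦
        star (angularVelocity X (a, s)) * angularVelocity X (a, s) :=
      hHH1.continuous.comp (by fun_prop : Continuous fun s : ℝ ↦ (a, s))
    have hi1 := integrable_inner_of_continuousOn h2k hV
    have hi2 := integrable_inner_of_continuousOn hTi (hc.continuousOn.clm_apply hT)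
    have hi0 : Integrable (fun s ↦ ‖k s‖ ^ 2) (volume.restrict (Ioo 0 L)) :=
      h.memLp.integrable_norm_pow two_ne_zero
    rw [← integral_add hi1 hi2, ← integral_add hi0 (hi1.fun_add hi2)]
    refine integral_congr_ae (Filter.Eventually.of_forall fun s ↦ ?_)
    simp only [norm_add_apply_sq, add_assoc]
  have hφ : HasStrictFDerivAt
      (fun a ↦ ∫ s in Ioo 0 L, ‖k s + angularVelocity X (a, s) (T s)‖ ^ 2) (D₁ + D₂) 0 := by
    simp only [henergy]
    exact (hD₁.add hD₂).const_add _
  have hext : IsLocalExtrOn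
      (fun a ↦ ∫ s in Ioo 0 L, ‖k s + angularVelocity X (a, s) (T s)‖ ^ 2)
      {a | ∫ s in Ioo 0 L, fieldRotation X (a, s) (T s) =
        ∫ s in Ioo 0 L, fieldRotation X (0, s) (T s)} 0 := by
    -- Each parameter in the constraint set yields an admissible competitor whose energy is the
    -- integral on the left, so `a = 0` is a minimum.
    refine Or.inl (IsMinOn.localize fun a ha ↦ ?_)
    have h0 : ∀ s, fieldRotation X (0, s) = 1 := fun s ↦ by
      rw [fieldRotation, fieldSum_zero, NormedSpace.exp_zero]
    have h0' : ∀ s, angularVelocity X (0, s) = 0 := fun s ↦ by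
      rw [angularVelocity, fieldSum_zero, fieldSum_zero, expLogDeriv_zero_left]
    have hP : ∫ s in Ioo 0 L, fieldRotation X (a, s) (T s) = P := by
      have ha' : ∫ s in Ioo 0 L, fieldRotation X (a, s) (T s) =
        ∫ s in Ioo 0 L, fieldRotation X (0, s) (T s) := ha
      rw [ha']
      simp only [h0, one_apply_eq_self]
      rw [integral_Ioo_eq_intervalIntegral hL, h.integral_eq]
    have hrot := h.rotate hL hX a
    rw [hP] at hrot
    have hle := hmin _ _ hrot
    simp only [norm_fieldRotation_apply hX] at hle
    simpa [h0'] using hle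
  obtain ⟨Λ, Λ₀, hne, hΛ⟩ := hext.exists_linear_map_of_hasStrictFDerivAt hD hφ
  refine ⟨Λ, Λ₀, hne, fun i ↦ ?_⟩
  -- In the i-th coordinate direction the rotation contributes `X i`, the angular velocity `deriv (X
  -- i)`, and the quadratic term nothing.
  have hi := hΛ (Pi.single i 1)
  have hd : ∀ s, HasDerivAt (fun t : ℝ ↦ fieldRotation X (t • Pi.single i 1, s)) (X i s) 0 :=
    fun s ↦ by
      simp only [fieldRotation, fieldSum_smul_single]
      exact hasDerivAt_exp_smul_zero _
  have hd₁ : ∀ s, HasDerivAt (fun t : ℝ ↦ angularVelocity X (t • Pi.single i 1, s))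
      (deriv (X i) s) 0 := fun s ↦ by
    simp only [angularVelocity, fieldSum_smul_single]
    exact hasDerivAt_expLogDeriv_smul_zero _ _
  have hd₂ : ∀ s, HasDerivAt (fun t : ℝ ↦ star (angularVelocity X (t • Pi.single i 1, s)) *
      angularVelocity X (t • Pi.single i 1, s)) 0 0 := fun s ↦ by
    simp only [angularVelocity, fieldSum_smul_single]
    exact hasDerivAt_star_mul_expLogDeriv_smul_zero _ _
  rw [add_apply, hD' _ _ hd, hD₁' _ _ hd₁, hD₂' _ _ hd₂] at hi
  simpa [real_inner_smul_left, integral_const_mul] using hi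

end Rotated

end Variations

theorem ae_eq_zero_of_integral_smul_eq_zero {G : Type*} [NormedAddCommGroup G] [NormedSpace ℝ G]
    [CompleteSpace G] {L : ℝ} {w : ℝ → G} (hw : Integrable w (volume.restrict (Ioo 0 L)))
    (h : ∀ φ, IsTest L φ → ∫ s in Ioo 0 L, φ s • w s = 0) :
    ∀ᵐ s ∂volume.restrict (Ioo 0 L), w s = 0 := by
  rw [ae_restrict_iff' measurableSet_Ioo]
  refine isOpen_Ioo.ae_eq_zero_of_integral_contDiff_smul_eq_zero
    (IntegrableOn.locallyIntegrableOn hw) fun φ h1 h2 h3 ↦ ?_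
  have hφ : IsTest L φ := ⟨h1, h2, h3⟩
  rw [← setIntegral_eq_integral_of_forall_compl_eq_zero (s := Ioo 0 L)
    fun x hx ↦ by rw [hφ.eq_zero hx, zero_smul]]
  exact h φ hφ

/-! ### The Euler-Lagrange equation. -/

section EulerLagrange

variable {E : Type*} [NormedAddCommGroup E] [InnerProductSpace ℝ E]
  {L : ℝ} {P V₀ V₁ : E} {T k : ℝ → E}

/-- The skew operator `x ↦ ⟪p, x⟫ w - ⟪w, x⟫ p`. -/
noncomputable def wedge (p w : E) : E →L[ℝ] E :=
  (innerSL ℝ p).smulRight w - (innerSL ℝ w).smulRight p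

@[simp]
theorem wedge_apply (p w x : E) : wedge p w x = inner ℝ p x • w - inner ℝ w x • p := rfl

theorem IsTest.isSkewField_smul_wedge {φ : ℝ → ℝ} (hφ : IsTest L φ) (p w : E) :
    IsSkewField L fun s ↦ φ s • wedge p w := by
  refine ⟨hφ.contDiff.smul contDiff_const, fun s x ↦ ?_, ?_, ?_⟩
  · simp only [smul_apply, wedge_apply, inner_smul_right, inner_sub_right]
    rw [real_inner_comm x p, real_inner_comm x w]
    ring
  · simp [hφ.eq_zero (s := 0) (by simp)]
  · simp [hφ.eq_zero (s := L) (by simp)]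

theorem IsTest.deriv_smul_wedge {φ : ℝ → ℝ} (hφ : IsTest L φ) (p w : E) (s : ℝ) :
    deriv (fun s ↦ φ s • wedge p w) s = deriv φ s • wedge p w :=
  ((hφ.contDiff.differentiable (by simp) s).hasDerivAt.smul_const (wedge p w)).deriv

theorem IsIndicatrix.ae_inner_eq_zero [CompleteSpace E] (hL : 0 ≤ L)
    (h : IsIndicatrix L P V₀ V₁ T k) :
    ∀ᵐ s ∂volume.restrict (Ioo 0 L), inner ℝ (T s) (k s) = 0 := by
  rw [ae_restrict_iff' measurableSet_Ioo]
  filter_upwards [h.isPrimitive.ae_hasDerivAt hL] with s hs hsI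
  have h1 := (hs hsI).norm_sq
  have h2 : HasDerivAt (fun s ↦ ‖T s‖ ^ 2) 0 s := by
    refine (hasDerivAt_const s (1 : ℝ)).congr_of_eventuallyEq ?_
    filter_upwards [Ioo_mem_nhds hsI.1 hsI.2] with t ht
    rw [h.norm_eq_one t (Ioo_subset_Icc_self ht), one_pow]
  simpa using h1.unique h2

/-- The integrand is the bending moment `wedge (k s) (T s) w`, the quantity that gains a derivative
from the weak equation. -/
theorem IsIndicatrix.integrable_moment (hL : 0 ≤ L) (h : IsIndicatrix L P V₀ V₁ T k) (w : E) :
    Integrable (fun s ↦ inner ℝ (k s) w • T s - inner ℝ w (T s) • k s)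
      (volume.restrict (Ioo 0 L)) := by
  have hki := h.isPrimitive.intervalIntegrable.integrable_Ioo hL
  have hTm : AEStronglyMeasurable T (volume.restrict (Ioo 0 L)) :=
    ((h.isPrimitive.continuousOn hL).mono Ioo_subset_Icc_self).aestronglyMeasurable
      measurableSet_Ioo
  refine Integrable.mono' (hki.norm.const_mul (2 * ‖w‖))
    (((hki.1.inner_const).smul hTm).sub ((hTm.const_inner).smul hki.1)) ?_
  filter_upwards [ae_restrict_mem measurableSet_Ioo] with s hs
  have h1 := h.norm_eq_one s (Ioo_subset_Icc_self hs)
  have h2 : ‖inner ℝ (k s) w • T s‖ ≤ ‖k s‖ * ‖w‖ := by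
    rw [norm_smul, h1, mul_one]
    exact norm_inner_le_norm _ _
  have h3 : ‖inner ℝ w (T s) • k s‖ ≤ ‖w‖ * ‖k s‖ := by
    rw [norm_smul]
    refine mul_le_mul_of_nonneg_right ((norm_inner_le_norm _ _).trans ?_) (norm_nonneg _)
    rw [h1, mul_one]
  calc _ ≤ ‖k s‖ * ‖w‖ + ‖w‖ * ‖k s‖ := (norm_sub_le _ _).trans (add_le_add h2 h3)
    _ = 2 * ‖w‖ * ‖k s‖ := by ring

variable [FiniteDimensional ℝ E]

/-- The Lagrange multiplier rule for all smooth fields of infinitesimal rotations. -/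
theorem IsIndicatrix.exists_multiplier (hL : 0 ≤ L) (h : IsIndicatrix L P V₀ V₁ T k)
    (hmin : ∀ T' k', IsIndicatrix L P V₀ V₁ T' k' →
      ∫ s in Ioo 0 L, ‖k s‖ ^ 2 ≤ ∫ s in Ioo 0 L, ‖k' s‖ ^ 2) :
    ∃ (l : E) (Λ₀ : ℝ), (l, Λ₀) ≠ 0 ∧ ∀ X, IsSkewField L X →
      inner ℝ l (∫ s in Ioo 0 L, X s (T s)) +
        Λ₀ * (2 * ∫ s in Ioo 0 L, inner ℝ (k s) (deriv X s (T s))) = 0 := by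
  have : CompleteSpace E := FiniteDimensional.complete ℝ E
  let vec : (ℝ → E →L[ℝ] E) → E × ℝ := fun X ↦ (∫ s in Ioo 0 L, X s (T s),
    2 * ∫ s in Ioo 0 L, inner ℝ (k s) (deriv X s (T s)))
  let S : Set (E × ℝ) := vec '' {X | IsSkewField L X}
  -- If the first variations spanned `E × ℝ`, finitely many of them would already span, and the
  -- nonzero multiplier of those fields would vanish on a spanning set.
  have key : ∃ f : E × ℝ →ₗ[ℝ] ℝ, f ≠ 0 ∧ ∀ v ∈ S, f v = 0 := by
    by_cases htop : Submodule.span ℝ S = ⊤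
    · exfalso
      obtain ⟨t, htS, ht⟩ := (Submodule.fg_span_iff_fg_span_finset_subset S).1
        (htop ▸ Module.Finite.fg_top)
      choose X hX hXv using fun v : t ↦ htS v.2
      obtain ⟨Λ, Λ₀, hne, hΛ⟩ := h.exists_multiplier_of_fintype hL hmin (X := X) hX
      let f : E × ℝ →ₗ[ℝ] ℝ := Λ.coprod (Λ₀ • LinearMap.id)
      have hf : f = 0 := by
        refine LinearMap.ext_on (htop ▸ ht.symm : Submodule.span ℝ (t : Set (E × ℝ)) = ⊤)
          fun v hv ↦ ?_
        have h1 := hΛ ⟨v, hv⟩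
        have h2 : vec (X ⟨v, hv⟩) = v := hXv ⟨v, hv⟩
        have h3 : f (vec (X ⟨v, hv⟩)) = 0 := by simpa [f, vec] using h1
        rw [LinearMap.zero_apply, ← h3, h2]
      refine hne (Prod.ext (LinearMap.ext fun x ↦ ?_) ?_)
      · simpa [f] using LinearMap.congr_fun hf (x, 0)
      · simpa [f] using LinearMap.congr_fun hf (0, 1)
    · obtain ⟨f, hf0, hf⟩ := Submodule.exists_le_ker_of_lt_top _ (lt_top_iff_ne_top.2 htop)
      exact ⟨f, hf0, fun v hv ↦ hf (Submodule.subset_span hv)⟩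
  obtain ⟨f, hf0, hf⟩ := key
  let Λ : E →ₗ[ℝ] ℝ := f.comp (LinearMap.inl ℝ E ℝ)
  let l := (InnerProductSpace.toDual ℝ E).symm (LinearMap.toContinuousLinearMap Λ)
  have hl : ∀ x, inner ℝ l x = f (x, 0) := fun x ↦ by simp [l, Λ]
  have hsplit : ∀ (x : E) (r : ℝ), f (x, r) = inner ℝ l x + f (0, 1) * r := fun x r ↦ by
    rw [hl, mul_comm, ← smul_eq_mul, ← map_smul, ← map_add]
    simp
  refine ⟨l, f (0, 1), fun h0 ↦ hf0 (LinearMap.ext fun v ↦ ?_), fun X hX ↦ ?_⟩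
  · have h1 : l = 0 := congrArg Prod.fst h0
    have h2 : f (0, 1) = 0 := congrArg Prod.snd h0
    rw [show v = (v.1, v.2) from rfl, hsplit, h1, h2]
    simp
  · rw [← hsplit]
    exact hf _ ⟨X, hX, rfl⟩

/-- The weak Euler-Lagrange equation. -/
theorem IsIndicatrix.exists_weak_euler_lagrange (hL : 0 ≤ L) (h : IsIndicatrix L P V₀ V₁ T k)
    (hmin : ∀ T' k', IsIndicatrix L P V₀ V₁ T' k' →
      ∫ s in Ioo 0 L, ‖k s‖ ^ 2 ≤ ∫ s in Ioo 0 L, ‖k' s‖ ^ 2) :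
    ∃ (l : E) (Λ₀ : ℝ), (l, Λ₀) ≠ 0 ∧ ∀ w φ, IsTest L φ →
      (∫ s in Ioo 0 L, φ s • (inner ℝ l w • T s - inner ℝ w (T s) • l)) +
        (2 * Λ₀) • ∫ s in Ioo 0 L, deriv φ s • (inner ℝ (k s) w • T s - inner ℝ w (T s) • k s) =
          0 := by
  have : CompleteSpace E := FiniteDimensional.complete ℝ E
  obtain ⟨l, Λ₀, hne, hl⟩ := h.exists_multiplier hL hmin
  -- Pairing with an arbitrary `p` reduces the vector identity to the multiplier rule for the field
  -- `φ • wedge p w`.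
  refine ⟨l, Λ₀, hne, fun w φ hφ ↦ ext_inner_left ℝ fun p ↦ ?_⟩
  have hT := h.isPrimitive.continuousOn hL
  have hTi : Integrable T (volume.restrict (Ioo 0 L)) :=
    hT.integrableOn_Icc.mono_set Ioo_subset_Icc_self
  have hφc := hφ.contDiff.continuous
  have hn : ContinuousOn (fun s ↦ inner ℝ l w • T s - inner ℝ w (T s) • l) (Icc 0 L) := by
    fun_prop
  have hni := Continuous.integrable_smul_Ioo
    (hn.integrableOn_Icc.mono_set Ioo_subset_Icc_self) hφc
  have hmi := Continuous.integrable_smul_Ioo (h.integrable_moment hL w)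
    (hφ.contDiff.continuous_deriv (by exact_mod_cast le_top))
  have hwi : Integrable (fun s ↦ (φ s • wedge p w) (T s)) (volume.restrict (Ioo 0 L)) := by
    exact Continuous.integrable_smul_Ioo (v := fun s ↦ wedge p w (T s))
      ((wedge p w).integrable_comp hTi) hφc
  have hX := hl _ (hφ.isSkewField_smul_wedge p w)
  rw [← integral_inner hwi] at hX
  rw [inner_add_right, inner_smul_right, ← integral_inner hni, ← integral_inner hmi,
    inner_zero_right]
  refine Eq.trans ?_ hX
  rw [← mul_assoc, mul_comm Λ₀ 2]
  congr 1
  · refine integral_congr_ae (Filter.Eventually.of_forall fun s ↦ ?_)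
    simp only [smul_apply, wedge_apply, inner_smul_right, inner_sub_right]
    rw [real_inner_comm p l]
    ring
  · congr 1
    refine integral_congr_ae (Filter.Eventually.of_forall fun s ↦ ?_)
    simp only [hφ.deriv_smul_wedge, smul_apply, wedge_apply, inner_smul_right, inner_sub_right]
    rw [real_inner_comm p (k s)]
    ring

/-- A clamped indicatrix with a degenerate multiplier is constant, hence its displacement has
maximal length. -/
theorem IsIndicatrix.le_norm_of_degenerate (hL : 0 < L) (h : IsIndicatrix L P V₀ V₁ T k) {l : E}
    (hl : l ≠ 0) (hdeg : ∀ s ∈ Icc 0 L, ∀ w, inner ℝ l w • T s = inner ℝ w (T s) • l) :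
    L ≤ ‖P‖ := by
  have : CompleteSpace E := FiniteDimensional.complete ℝ E
  have hT := h.isPrimitive.continuousOn hL.le
  -- Norms in the degeneracy relation with `w = T s` give |⟨l, T⟩| = ‖l‖. By connectedness the sign
  -- is constant, so |⟨l, P⟩| = L ‖l‖, and Cauchy-Schwarz concludes.
  have hsq : ∀ s ∈ Icc 0 L, inner ℝ l (T s) ^ 2 = ‖l‖ ^ 2 := fun s hs ↦ by
    have h1 := congrArg (inner ℝ l) (hdeg s hs l)
    rw [inner_smul_right, inner_smul_right, real_inner_self_eq_norm_sq] at h1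
    have h2 := congrArg (inner ℝ (T s)) (hdeg s hs (T s))
    rw [inner_smul_right, inner_smul_right, real_inner_self_eq_norm_sq, h.norm_eq_one s hs,
      real_inner_comm l (T s)] at h2
    have h3 := congrArg norm (hdeg s hs (T s))
    rw [norm_smul, norm_smul, h.norm_eq_one s hs, real_inner_self_eq_norm_sq,
      h.norm_eq_one s hs] at h3
    rw [← sq_abs, ← Real.norm_eq_abs]
    simp only [mul_one, one_pow, norm_one, one_mul] at h3
    rw [h3]
  have hcont : ContinuousOn (fun s ↦ inner ℝ l (T s)) (Icc 0 L) := by fun_prop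
  have hln : ‖l‖ ≠ 0 := norm_ne_zero_iff.2 hl
  have hTi : IntervalIntegrable T volume 0 L :=
    ContinuousOn.intervalIntegrable (by rwa [uIcc_of_le hL.le])
  have hint : inner ℝ l P = ∫ s in 0..L, inner ℝ l (T s) := by
    rw [← h.integral_eq]
    exact ((innerSL ℝ l).intervalIntegral_comp_comm hTi).symm
  have habs : |inner ℝ l P| = L * ‖l‖ := by
    rw [hint]
    rcases isPreconnected_Icc.eq_or_eq_neg_of_sq_eq hcont (continuousOn_const (c := ‖l‖))
      (fun s hs ↦ hsq s hs) (fun _ ↦ hln) with he | he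
    · rw [intervalIntegral.integral_congr (g := fun _ ↦ ‖l‖)
        fun s hs ↦ he (by rwa [uIcc_of_le hL.le] at hs)]
      simp [abs_of_pos hL]
    · rw [intervalIntegral.integral_congr (g := fun _ ↦ -‖l‖)
        fun s hs ↦ he (by rwa [uIcc_of_le hL.le] at hs)]
      simp [abs_of_pos hL]
  have hcs := abs_real_inner_le_norm l P
  rw [habs, mul_comm] at hcs
  exact le_of_mul_le_mul_left hcs (norm_pos_iff.2 hl)

/-- Minimizing indicatrices with submaximal displacement are of class `C²` and solve the
Euler-Lagrange equation `T'' = -q T + c`. -/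
theorem IsIndicatrix.exists_euler_lagrange (hL : 0 < L) (h : IsIndicatrix L P V₀ V₁ T k)
    (hmin : ∀ T' k', IsIndicatrix L P V₀ V₁ T' k' →
      ∫ s in Ioo 0 L, ‖k s‖ ^ 2 ≤ ∫ s in Ioo 0 L, ‖k' s‖ ^ 2) (hP : ‖P‖ < L) :
    ∃ (K : ℝ → E) (q : ℝ → ℝ) (c : E), ContinuousOn q (Icc 0 L) ∧
      (∀ s ∈ Icc 0 L, HasDerivWithinAt T (K s) (Icc 0 L) s) ∧
      ∀ w, ∀ s ∈ Icc 0 L, HasDerivWithinAt (fun s ↦ inner ℝ (K s) w)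
        (-(q s * inner ℝ (T s) w) + inner ℝ c w) (Icc 0 L) s := by
  have : CompleteSpace E := FiniteDimensional.complete ℝ E
  obtain ⟨l, Λ₀, hne, hEL⟩ := h.exists_weak_euler_lagrange hL.le hmin
  have hT := h.isPrimitive.continuousOn hL.le
  set n : E → ℝ → E := fun w s ↦ inner ℝ l w • T s - inner ℝ w (T s) • l with hn
  set m : E → ℝ → E := fun w s ↦ inner ℝ (k s) w • T s - inner ℝ w (T s) • k s with hm
  have hnc : ∀ w, ContinuousOn (n w) (Icc 0 L) := fun w ↦ by simp only [hn]; fun_prop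
  have hni : ∀ w, Integrable (n w) (volume.restrict (Ioo 0 L)) := fun w ↦
    (hnc w).integrableOn_Icc.mono_set Ioo_subset_Icc_self
  -- For Λ₀ = 0 the weak equation says `n w = 0` for every `w`, which is the degenerate case.
  have hΛ : Λ₀ ≠ 0 := by
    intro h0
    have hl : l ≠ 0 := fun hl ↦ hne (by rw [hl, h0]; rfl)
    refine absurd (h.le_norm_of_degenerate hL hl fun s hs w ↦ ?_) (not_le.2 hP)
    have h1 : ∀ᵐ s ∂volume.restrict (Ioo 0 L), n w s = 0 :=
      ae_eq_zero_of_integral_smul_eq_zero (hni w) fun φ hφ ↦ by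
        simpa [h0] using hEL w φ hφ
    exact sub_eq_zero.1 (eqOn_Icc_of_ae_eq hL (hnc w) continuousOn_const h1 hs)
  set μ : ℝ := (2 * Λ₀)⁻¹ with hμ
  have hμn : ∀ w, ContinuousOn (fun s ↦ μ • n w s) (Icc 0 L) := fun w ↦ (hnc w).const_smul μ
  have hparts : ∀ w, IntegratesByParts L (m w) (fun s ↦ μ • n w s) := fun w φ hφ ↦ by
    have h2 : (2 * Λ₀) ≠ 0 := mul_ne_zero two_ne_zero hΛ
    have h1 := hEL w φ hφ
    simp only [smul_comm _ μ]
    rw [integral_smul]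
    have h3 := congrArg (fun x ↦ μ • x) h1
    simp only [smul_add, smul_zero, smul_smul, hμ, inv_mul_cancel₀ h2, one_smul] at h3
    exact eq_neg_of_add_eq_zero_right h3
  choose a ha using fun w ↦ (hparts w).ae_eq_const_add_integral hL (h.integrable_moment hL.le w)
    (ContinuousOn.intervalIntegrable (by rw [uIcc_of_le hL.le]; exact hμn w))
  set M : E → ℝ → E := fun w s ↦ a w + ∫ t in 0..s, μ • n w t with hM
  have hMd : ∀ w, ∀ s ∈ Icc 0 L, HasDerivWithinAt (M w) (μ • n w s) (Icc 0 L) s := fun w s hs ↦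
    (hasDerivWithinAt_integral_Icc (hμn w) hs).const_add _
  have hMc : ∀ w, ContinuousOn (M w) (Icc 0 L) := fun w s hs ↦ (hMd w s hs).continuousWithinAt
  set b := stdOrthonormalBasis ℝ E with hb
  -- From |T| = 1 and ⟨T, k⟩ = 0 one gets ⟨T, m w⟩ = ⟨k, w⟩ almost everywhere. Replacing `m` by its
  -- continuous representative `M` gives one for `k`.
  set K : ℝ → E := fun s ↦ ∑ i, inner ℝ (T s) (M (b i) s) • b i with hK
  have hKc : ContinuousOn K (Icc 0 L) := continuousOn_finsetSum _ fun i _ ↦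
    (hT.inner (hMc (b i))).smul continuousOn_const
  have hTk := h.ae_inner_eq_zero hL.le
  have hkK : ∀ᵐ s ∂volume.restrict (Ioo 0 L), k s = K s := by
    have hall : ∀ᵐ s ∂volume.restrict (Ioo 0 L), ∀ i, m (b i) s = M (b i) s :=
      ae_all_iff.2 fun i ↦ ha (b i)
    filter_upwards [hall, hTk, ae_restrict_mem measurableSet_Ioo] with s hs h0 hsI
    conv_lhs => rw [← b.sum_repr' (k s)]
    refine Finset.sum_congr rfl fun i _ ↦ ?_
    rw [← hs i]
    simp only [hm, inner_sub_right, inner_smul_right, h0, real_inner_self_eq_norm_sq,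
      h.norm_eq_one s (Ioo_subset_Icc_self hsI)]
    rw [real_inner_comm (b i) (k s)]
    simp
  have hTK : ∀ s ∈ Icc 0 L, inner ℝ (T s) (K s) = 0 :=
    eqOn_Icc_of_ae_eq hL (hT.inner hKc) continuousOn_const (by
      filter_upwards [hTk, hkK] with s h1 h2
      rw [← h2, h1])
  have hMK : ∀ w, ∀ s ∈ Icc 0 L, M w s = inner ℝ (K s) w • T s - inner ℝ w (T s) • K s := fun w ↦
    eqOn_Icc_of_ae_eq hL (hMc w) (by fun_prop) (by
      filter_upwards [ha w, hkK] with s h1 h2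
      rw [← h2]
      exact h1.symm)
  have hTd : ∀ s ∈ Icc 0 L, HasDerivWithinAt T (K s) (Icc 0 L) s := by
    have hTe : ∀ s ∈ Icc 0 L, T s = T 0 + ∫ t in 0..s, K t := fun s hs ↦ by
      rw [h.isPrimitive.eq_add_integral s hs]
      congr 1
      rw [intervalIntegral.integral_of_le hs.1, intervalIntegral.integral_of_le hs.1,
        integral_Ioc_eq_integral_Ioo, integral_Ioc_eq_integral_Ioo]
      exact integral_congr_ae (ae_restrict_of_ae_restrict_of_subset (Ioo_subset_Ioo_right hs.2) hkK)
    intro s hs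
    exact ((hasDerivWithinAt_integral_Icc hKc hs).const_add (T 0)).congr_of_mem hTe hs
  -- Differentiate ⟨K, w⟩ = ⟨T, M w⟩: here ⟨K, M w⟩ = -‖K‖² ⟨T, w⟩ and ⟨T, μ n w⟩ = μ (⟨l, w⟩ - ⟨T,
  -- l⟩ ⟨T, w⟩).
  refine ⟨K, fun s ↦ ‖K s‖ ^ 2 + μ * inner ℝ (T s) l, μ • l, by fun_prop, hTd, fun w s hs ↦ ?_⟩
  have hd := (hTd s hs).inner ℝ (hMd w s hs)
  have hval : inner ℝ (T s) (μ • n w s) + inner ℝ (K s) (M w s) =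
      -((‖K s‖ ^ 2 + μ * inner ℝ (T s) l) * inner ℝ (T s) w) + inner ℝ (μ • l) w := by
    rw [hMK w s hs]
    simp only [hn, inner_sub_right, inner_smul_right, real_inner_smul_left,
      real_inner_self_eq_norm_sq, h.norm_eq_one s hs]
    rw [real_inner_comm (T s) (K s), hTK s hs, real_inner_comm w (T s)]
    ring
  rw [hval] at hd
  refine hd.congr_of_mem (fun t ht ↦ ?_) hs
  rw [hMK w t ht]
  simp only [inner_sub_right, inner_smul_right, real_inner_self_eq_norm_sq, h.norm_eq_one t ht,
    hTK t ht]
  ring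

end EulerLagrange

/-! ### Reflecting an arc of the curve. -/

section Reflection

variable {L s₁ s₂ : ℝ}

/-- Truncation at two zeros creates no jump: for s ≥ s₁ the truncated function is F (min s s₂). -/
theorem IsPrimitive.indicator {F φ : ℝ → ℝ} (hF : IsPrimitive L F φ) (h0 : 0 ≤ s₁)
    (h12 : s₁ ≤ s₂) (h2 : s₂ ≤ L) (hF1 : F s₁ = 0) (hF2 : F s₂ = 0) :
    IsPrimitive L ((Icc s₁ s₂).indicator F) ((Ioc s₁ s₂).indicator φ) := by
  have hL : 0 ≤ L := h0.trans (h12.trans h2)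
  have hi : ∀ x ∈ Icc 0 L, IntervalIntegrable φ volume 0 x := fun x hx ↦
    hF.intervalIntegrable.mono_set (by
      rw [uIcc_of_le hL, uIcc_of_le hx.1]
      exact Icc_subset_Icc_right hx.2)
  have hzero : (Icc s₁ s₂).indicator F 0 = 0 := by
    by_cases h : (0 : ℝ) ∈ Icc s₁ s₂
    · have h10 : s₁ = 0 := le_antisymm h.1 h0
      rw [indicator_of_mem h]
      exact (congrArg F h10.symm).trans hF1
    · rw [indicator_of_notMem h]
  refine ⟨?_, fun s hs ↦ ?_⟩
  · rw [intervalIntegrable_iff] at *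
    exact hF.intervalIntegrable.def'.indicator measurableSet_Ioc
  · rw [hzero, zero_add, intervalIntegral.integral_of_le hs.1, setIntegral_indicator
      measurableSet_Ioc, Ioc_inter_Ioc, max_eq_right h0]
    rcases lt_or_ge s s₁ with hlt | hge
    · rw [indicator_of_notMem fun h ↦ absurd h.1 (not_le.2 hlt), Ioc_eq_empty, setIntegral_empty]
      exact not_lt.2 ((min_le_left _ _).trans hlt.le)
    · have hm1 : s₁ ∈ Icc 0 L := ⟨h0, h12.trans h2⟩
      have hm2 : min s s₂ ∈ Icc 0 L := ⟨le_min hs.1 (h0.trans h12), (min_le_left _ _).trans hs.2⟩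
      rw [← intervalIntegral.integral_of_le (le_min hge h12),
        ← intervalIntegral.integral_interval_sub_left (hi _ hm2) (hi _ hm1)]
      have e1 := hF.eq_add_integral _ hm1
      have e2 := hF.eq_add_integral _ hm2
      have e3 : (Icc s₁ s₂).indicator F s = F (min s s₂) := by
        rcases le_or_gt s s₂ with hle | hgt
        · rw [indicator_of_mem (show s ∈ Icc s₁ s₂ from ⟨hge, hle⟩), min_eq_left hle]
        · rw [indicator_of_notMem fun h ↦ absurd h.2 (not_le.2 hgt), min_eq_right hgt.le, hF2]
      rw [e3]
      linarith

variable {E : Type*} [NormedAddCommGroup E] [InnerProductSpace ℝ E]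
  {P V₀ V₁ : E} {T k : ℝ → E} {ω : E}

theorem norm_sub_two_inner_smul (hω : ‖ω‖ = 1) (x : E) : ‖x - (2 * inner ℝ ω x) • ω‖ = ‖x‖ := by
  refine (sq_eq_sq₀ (norm_nonneg _) (norm_nonneg _)).1 ?_
  rw [norm_sub_sq_real, norm_smul, hω, inner_smul_right, real_inner_comm ω x, Real.norm_eq_abs,
    mul_one, sq_abs]
  ring

theorem norm_sub_two_indicator_smul (hω : ‖ω‖ = 1) (A : Set ℝ) (u : ℝ → E) (s : ℝ) :
    ‖u s - (2 * A.indicator (fun t ↦ inner ℝ ω (u t)) s) • ω‖ = ‖u s‖ := by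
  by_cases h : s ∈ A
  · rw [indicator_of_mem h, norm_sub_two_inner_smul hω]
  · rw [indicator_of_notMem h, mul_zero, zero_smul, sub_zero]

/-- The conditions at s₁ and s₂ keep the tangent continuous, and the vanishing integral preserves
the displacement. -/
theorem IsIndicatrix.reflect [CompleteSpace E] (h : IsIndicatrix L P V₀ V₁ T k) (h0 : 0 ≤ s₁)
    (h12 : s₁ ≤ s₂) (h2 : s₂ ≤ L) (hω : ‖ω‖ = 1) (hT1 : inner ℝ ω (T s₁) = 0)
    (hT2 : inner ℝ ω (T s₂) = 0) (hint : ∫ s in s₁..s₂, inner ℝ ω (T s) = 0) :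
    IsIndicatrix L P V₀ V₁
      (fun s ↦ T s - (2 * (Icc s₁ s₂).indicator (fun t ↦ inner ℝ ω (T t)) s) • ω)
      (fun s ↦ k s - (2 * (Ioc s₁ s₂).indicator (fun t ↦ inner ℝ ω (k t)) s) • ω) := by
  have hL : 0 ≤ L := h0.trans (h12.trans h2)
  have hF : IsPrimitive L (fun s ↦ inner ℝ ω (T s)) (fun s ↦ inner ℝ ω (k s)) := by
    have := h.isPrimitive.clm_apply (H := ℝ) hL (Φ := fun _ ↦ innerSL ℝ ω) contDiff_const
    simpa using this
  have hG := hF.indicator h0 h12 h2 hT1 hT2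
  set G := (Icc s₁ s₂).indicator fun t ↦ inner ℝ ω (T t) with hGdef
  set g := (Ioc s₁ s₂).indicator fun t ↦ inner ℝ ω (k t) with hgdef
  have hGω := hG.clm_apply (H := E) hL
    (Φ := fun _ ↦ (ContinuousLinearMap.id ℝ ℝ).smulRight ((2 : ℝ) • ω)) contDiff_const
  simp only [deriv_const, zero_apply, zero_add, ContinuousLinearMap.smulRight_apply,
    ContinuousLinearMap.id_apply, smul_smul, mul_comm _ (2 : ℝ)] at hGω
  have hp : IsPrimitive L (fun s ↦ T s - (2 * G s) • ω) (fun s ↦ k s - (2 * g s) • ω) := by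
    refine ⟨h.isPrimitive.intervalIntegrable.sub hGω.intervalIntegrable, fun s hs ↦ ?_⟩
    have hsub : uIcc 0 s ⊆ uIcc 0 L := by
      rw [uIcc_of_le hL, uIcc_of_le hs.1]
      exact Icc_subset_Icc_right hs.2
    rw [intervalIntegral.integral_sub (h.isPrimitive.intervalIntegrable.mono_set hsub)
      (hGω.intervalIntegrable.mono_set hsub), h.isPrimitive.eq_add_integral s hs,
      hGω.eq_add_integral s hs]
    abel
  have hG0 : ∀ s, s ≤ s₁ ∨ s₂ ≤ s → G s = 0 := by
    intro s hs
    by_cases hm : s ∈ Icc s₁ s₂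
    · rw [hGdef, indicator_of_mem hm]
      rcases hs with hs | hs
      · rw [le_antisymm hs hm.1, hT1]
      · rw [← le_antisymm hs hm.2, hT2]
    · rw [hGdef, indicator_of_notMem hm]
  refine ⟨?_, hp, fun s hs ↦ ?_, ?_, ?_, ?_⟩
  · exact h.memLp.of_le (hp.intervalIntegrable.integrable_Ioo hL).1
      (Filter.Eventually.of_forall fun s ↦ (norm_sub_two_indicator_smul hω _ k s).le)
  · rw [hGdef, norm_sub_two_indicator_smul hω, h.norm_eq_one s hs]
  · rw [hG0 0 (Or.inl h0), mul_zero, zero_smul, sub_zero, h.left]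
  · rw [hG0 L (Or.inr h2), mul_zero, zero_smul, sub_zero, h.right]
  · have hTi : IntervalIntegrable T volume 0 L :=
      ContinuousOn.intervalIntegrable (by
        rw [uIcc_of_le hL]; exact h.isPrimitive.continuousOn hL)
    have hGi : IntervalIntegrable (fun s ↦ (2 * G s) • ω) volume 0 L :=
      ContinuousOn.intervalIntegrable (by rw [uIcc_of_le hL]; exact hGω.continuousOn hL)
    have hGint : ∫ s in 0..L, G s = 0 := by
      refine Eq.trans ?_ hint
      rw [intervalIntegral.integral_of_le hL, ← integral_Icc_eq_integral_Ioc,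
        setIntegral_indicator measurableSet_Icc, Icc_inter_Icc, max_eq_right h0, min_eq_right h2,
        intervalIntegral.integral_of_le h12, integral_Icc_eq_integral_Ioc]
    rw [intervalIntegral.integral_sub hTi hGi, intervalIntegral.integral_smul_const,
      intervalIntegral.integral_const_mul, hGint, h.integral_eq, mul_zero, zero_smul, sub_zero]

end Reflection

/-! ### Uniqueness for the scalar equation f'' = -q f + c. -/

section LinearODE

variable {L : ℝ} {f g q f' g' q' : ℝ → ℝ} {c c' : ℝ}

/-- A solution of `f'' = -q f` with vanishing Cauchy data at an interior point vanishes. -/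
theorem eqOn_zero_of_linear_ode (hq : ContinuousOn q (Icc 0 L))
    (hf : ∀ s ∈ Icc 0 L, HasDerivWithinAt f (g s) (Icc 0 L) s)
    (hg : ∀ s ∈ Icc 0 L, HasDerivWithinAt g (-(q s * f s)) (Icc 0 L) s) {σ : ℝ}
    (hσ : σ ∈ Ioo 0 L) (hfσ : f σ = 0) (hgσ : g σ = 0) : EqOn f 0 (Icc 0 L) := by
  obtain ⟨C, hC⟩ := isCompact_Icc.exists_bound_of_continuousOn hq
  have hlip : ∀ t ∈ Ioo 0 L, LipschitzOnWith (max 1 C.toNNReal)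
      (fun p : ℝ × ℝ ↦ (p.2, -(q t * p.1))) univ := fun t ht ↦ by
    refine LipschitzOnWith.of_dist_le_mul fun x _ y _ ↦ ?_
    have h1 : |q t| ≤ C := hC t (Ioo_subset_Icc_self ht)
    have hC0 : 0 ≤ C := (abs_nonneg _).trans h1
    rw [Prod.dist_eq, Prod.dist_eq, NNReal.coe_max, Real.coe_toNNReal _ hC0]
    simp only [Real.dist_eq, NNReal.coe_one]
    refine max_le ?_ ?_
    · calc |x.2 - y.2| = 1 * |x.2 - y.2| := (one_mul _).symm
        _ ≤ _ := mul_le_mul (le_max_left _ _) (le_max_right _ _) (abs_nonneg _)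
          (zero_le_one.trans (le_max_left _ _))
    · calc |-(q t * x.1) - -(q t * y.1)| = |q t| * |x.1 - y.1| := by
            rw [← abs_mul, ← abs_neg]; ring_nf
        _ ≤ _ := mul_le_mul (h1.trans (le_max_right _ _)) (le_max_left _ _) (abs_nonneg _)
          (zero_le_one.trans (le_max_left _ _))
  have hint : ∀ t ∈ Ioo 0 L, Icc 0 L ∈ nhds t := fun t ht ↦ Icc_mem_nhds ht.1 ht.2
  have h := ODE_solution_unique_of_mem_Icc (f := fun s ↦ (f s, g s)) (g := fun _ ↦ (0, 0))
    hlip hσ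
    (fun s hs ↦ (hf s hs).continuousWithinAt.prodMk (hg s hs).continuousWithinAt)
    (fun t ht ↦ ((hf t (Ioo_subset_Icc_self ht)).hasDerivAt (hint t ht)).prodMk
      ((hg t (Ioo_subset_Icc_self ht)).hasDerivAt (hint t ht)))
    (fun _ _ ↦ mem_univ _) continuousOn_const
    (fun t _ ↦ by
      convert! hasDerivAt_const t ((0 : ℝ), (0 : ℝ)) using 1
      simp)
    (fun _ _ ↦ mem_univ _) (by simp only [hfσ, hgσ])
  exact fun s hs ↦ congrArg Prod.fst (h hs)

/-- If two solutions of `f'' = -q f + c` are proportional on a subinterval, then so are their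
derivatives up to order two. -/
theorem proportional_deriv_of_proportional {u v ε : ℝ} (huv : u < v)
    (hsub : Icc u v ⊆ Icc 0 L)
    (hf : ∀ s ∈ Icc 0 L, HasDerivWithinAt f (g s) (Icc 0 L) s)
    (hg : ∀ s ∈ Icc 0 L, HasDerivWithinAt g (-(q s * f s) + c) (Icc 0 L) s)
    (hf' : ∀ s ∈ Icc 0 L, HasDerivWithinAt f' (g' s) (Icc 0 L) s)
    (hg' : ∀ s ∈ Icc 0 L, HasDerivWithinAt g' (-(q' s * f' s) + c') (Icc 0 L) s)
    (hε : ∀ s ∈ Icc u v, f' s = ε * f s) :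
    ∀ s ∈ Icc u v, g' s = ε * g s ∧ -(q' s * f' s) + c' = ε * (-(q s * f s) + c) := by
  -- Derivatives within a nondegenerate closed interval are unique, so the relations reach its
  -- endpoints.
  have hu := uniqueDiffOn_Icc huv
  have h1 : ∀ s ∈ Icc u v, g' s = ε * g s := fun s hs ↦
    (hu s hs).eq_deriv _ ((hf' s (hsub hs)).mono hsub)
      ((((hf s (hsub hs)).mono hsub).const_mul ε).congr_of_mem hε hs)
  exact fun s hs ↦ ⟨h1 s hs, (hu s hs).eq_deriv _ ((hg' s (hsub hs)).mono hsub)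
    ((((hg s (hsub hs)).mono hsub).const_mul ε).congr_of_mem h1 hs)⟩

/-- Two solutions of equations `f'' = -q f + c`, equal on one side of an interior zero and opposite
on the other side, vanish identically. -/
theorem eqOn_zero_of_reflected {u σ v ε ε' : ℝ} (huσ : u < σ) (hσv : σ < v) (hu : 0 ≤ u)
    (hv : v ≤ L) (hεε : ε ≠ ε') (hq : ContinuousOn q (Icc 0 L))
    (hf : ∀ s ∈ Icc 0 L, HasDerivWithinAt f (g s) (Icc 0 L) s)
    (hg : ∀ s ∈ Icc 0 L, HasDerivWithinAt g (-(q s * f s) + c) (Icc 0 L) s)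
    (hf' : ∀ s ∈ Icc 0 L, HasDerivWithinAt f' (g' s) (Icc 0 L) s)
    (hg' : ∀ s ∈ Icc 0 L, HasDerivWithinAt g' (-(q' s * f' s) + c') (Icc 0 L) s)
    (hfσ : f σ = 0) (hε : ∀ s ∈ Icc u σ, f' s = ε * f s)
    (hε' : ∀ s ∈ Icc σ v, f' s = ε' * f s) : EqOn f 0 (Icc 0 L) := by
  obtain ⟨h1, h2⟩ := proportional_deriv_of_proportional huσ
    (Icc_subset_Icc hu (hσv.le.trans hv)) hf hg hf' hg' hε σ ⟨huσ.le, le_rfl⟩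
  obtain ⟨h3, h4⟩ := proportional_deriv_of_proportional hσv
    (Icc_subset_Icc (hu.trans huσ.le) hv) hf hg hf' hg' hε' σ ⟨le_rfl, hσv.le⟩
  -- The values at `σ` of `g'` and of its derivative are the same from both sides, so the distinct
  -- factors force `g σ = 0` and, since `f σ = 0`, also `c = 0`.
  have hne : ε - ε' ≠ 0 := sub_ne_zero.2 hεε
  have hgσ : g σ = 0 := by
    have : (ε - ε') * g σ = 0 := by linarith
    exact (mul_eq_zero.1 this).resolve_left hne
  have hc : c = 0 := by
    rw [hfσ, mul_zero, neg_zero, zero_add] at h2 h4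
    have : (ε - ε') * c = 0 := by linarith
    exact (mul_eq_zero.1 this).resolve_left hne
  exact eqOn_zero_of_linear_ode hq hf (fun s hs ↦ by simpa [hc] using hg s hs)
    ⟨hu.trans_lt huσ, hσv.trans_le hv⟩ hfσ hgσ

end LinearODE

/-! ### The contradiction for a minimizer. -/

theorem theorem7p1 (L : ℝ) (hL : 0 < L) (P₀ P₁ V₀ V₁ : E3) (hP : dist P₀ P₁ < L)
    (hV₀ : ‖V₀‖ = 1) (hV₁ : ‖V₁‖ = 1)
    (γ : ℝ → E3) (hγ : γ ∈ clampedCurves L P₀ P₁ V₀ V₁)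
    (s₁ s₂ : ℝ) (hs₁ : 0 ≤ s₁) (hs : s₁ < s₂) (hs₂ : s₂ ≤ L) (hs₁₂ : s₂ - s₁ < L)
    (ω : E3) (hω : ‖ω‖ = 1)
    (hγω : inner ℝ (γ s₂ - γ s₁) ω = 0)
    (hω₁ : inner ℝ (tangent L γ s₁) ω = 0) (hω₂ : inner ℝ (tangent L γ s₂) ω = 0)
    (hk : (∃ k : E3, HasDerivWithinAt (tangent L γ) k (Icc 0 L) s₁ ∧ inner ℝ k ω ≠ 0) ∨
      (∃ k : E3, HasDerivWithinAt (tangent L γ) k (Icc 0 L) s₂ ∧ inner ℝ k ω ≠ 0)) :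
    ¬ IsMinOn (bendingEnergy L) (clampedCurves L P₀ P₁ V₀ V₁) γ := by
  intro hmin
  obtain ⟨hprim, k, hT, hB⟩ := exists_isIndicatrix_of_mem_clampedCurves hL hγ
  set T := tangent L γ with hTdef
  have hs₁m : s₁ ∈ Icc 0 L := ⟨hs₁, hs.le.trans hs₂⟩
  have hs₂m : s₂ ∈ Icc 0 L := ⟨hs₁.trans hs.le, hs₂⟩
  have hPn : ‖P₁ - P₀‖ < L := by rwa [← dist_eq_norm, dist_comm]
  have hminT : ∀ T' k', IsIndicatrix L (P₁ - P₀) V₀ V₁ T' k' →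
      ∫ s in Ioo 0 L, ‖k s‖ ^ 2 ≤ ∫ s in Ioo 0 L, ‖k' s‖ ^ 2 := fun T' k' h' ↦ by
    obtain ⟨γ', hγ', hB'⟩ := h'.exists_mem_clampedCurves hL
    rw [← hB, ← hB']
    exact hmin hγ'
  have hω₁' : inner ℝ ω (T s₁) = 0 := by rw [real_inner_comm]; exact hω₁
  have hω₂' : inner ℝ ω (T s₂) = 0 := by rw [real_inner_comm]; exact hω₂
  have hTi : ∀ s ∈ Icc 0 L, IntervalIntegrable T volume 0 s := fun s hs ↦
    hprim.intervalIntegrable.mono_set (by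
      rw [uIcc_of_le hL.le, uIcc_of_le hs.1]
      exact Icc_subset_Icc_right hs.2)
  have hint : ∫ s in s₁..s₂, inner ℝ ω (T s) = 0 := by
    have h1 := (innerSL ℝ ω).intervalIntegral_comp_comm
      ((hTi s₁ hs₁m).symm.trans (hTi s₂ hs₂m))
    refine Eq.trans h1 ?_
    refine Eq.trans ?_ hγω
    rw [innerSL_apply_apply, ← intervalIntegral.integral_interval_sub_left (hTi _ hs₂m)
      (hTi _ hs₁m), real_inner_comm, hprim.eq_add_integral s₁ hs₁m,
      hprim.eq_add_integral s₂ hs₂m, add_sub_add_left_eq_sub]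
  have hR := hT.reflect hs₁ hs.le hs₂ hω hω₁' hω₂' hint
  -- The reflection preserves `‖k s‖` pointwise, so the reflected indicatrix is a minimizer too.
  have hminR : ∀ T' k', IsIndicatrix L (P₁ - P₀) V₀ V₁ T' k' →
      ∫ s in Ioo 0 L, ‖k s - (2 * (Ioc s₁ s₂).indicator (fun t ↦ inner ℝ ω (k t)) s) • ω‖ ^ 2 ≤
        ∫ s in Ioo 0 L, ‖k' s‖ ^ 2 := fun T' k' h' ↦ by
    simp only [norm_sub_two_indicator_smul hω]
    exact hminT T' k' h'
  obtain ⟨K, q, c, hq, hTd, hKd⟩ := hT.exists_euler_lagrange hL hminT hPn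
  obtain ⟨K', q', c', -, hTd', hKd'⟩ := hR.exists_euler_lagrange hL hminR hPn
  have hf : ∀ {U V : ℝ → E3}, (∀ s ∈ Icc 0 L, HasDerivWithinAt U (V s) (Icc 0 L) s) →
      ∀ s ∈ Icc 0 L, HasDerivWithinAt (fun s ↦ inner ℝ (U s) ω) (inner ℝ (V s) ω) (Icc 0 L) s :=
    fun h s hs ↦ by simpa using (h s hs).inner ℝ (hasDerivWithinAt_const s (Icc 0 L) ω)
  have hωω : inner ℝ ω ω = (1 : ℝ) := by rw [real_inner_self_eq_norm_sq, hω, one_pow]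
  have hmid : ∀ s ∈ Icc s₁ s₂,
      inner ℝ (T s - (2 * (Icc s₁ s₂).indicator (fun t ↦ inner ℝ ω (T t)) s) • ω) ω =
        -1 * inner ℝ (T s) ω := fun s hsI ↦ by
    rw [indicator_of_mem hsI, inner_sub_left, real_inner_smul_left, hωω, real_inner_comm (T s) ω]
    ring
  have hout : ∀ s, s ≤ s₁ ∨ s₂ ≤ s →
      inner ℝ (T s - (2 * (Icc s₁ s₂).indicator (fun t ↦ inner ℝ ω (T t)) s) • ω) ω =
        1 * inner ℝ (T s) ω := fun s hsI ↦ by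
    have h0 : (Icc s₁ s₂).indicator (fun t ↦ inner ℝ ω (T t)) s = 0 := by
      by_cases hm : s ∈ Icc s₁ s₂
      · rw [indicator_of_mem hm]
        rcases hsI with hle | hle
        · rw [le_antisymm hle hm.1, hω₁']
        · rw [← le_antisymm hle hm.2, hω₂']
      · rw [indicator_of_notMem hm]
    rw [h0, mul_zero, zero_smul, sub_zero, one_mul]
  -- An interior end of the arc serves as σ: `s₂` if `s₂ < L`, otherwise `s₁`, which is positive
  -- because `s₂ - s₁ < L`.
  have hzero : EqOn (fun s ↦ inner ℝ (T s) ω) 0 (Icc 0 L) := by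
    rcases hs₂.lt_or_eq with hlt | heq
    · exact eqOn_zero_of_reflected hs hlt hs₁ le_rfl (by norm_num) hq (hf hTd) (hKd ω)
        (hf hTd') (hKd' ω) hω₂ hmid fun s hsI ↦ hout s (Or.inr hsI.1)
    · exact eqOn_zero_of_reflected (show 0 < s₁ by linarith) hs le_rfl hs₂ (by norm_num) hq
        (hf hTd) (hKd ω) (hf hTd') (hKd' ω) hω₁ (fun s hsI ↦ hout s (Or.inl hsI.2)) hmid
  have hcontra : ∀ s ∈ Icc 0 L, ∀ k : E3, HasDerivWithinAt T k (Icc 0 L) s →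
      inner ℝ k ω = 0 := fun s hsI k hkd ↦ by
    have h1 := hkd.inner ℝ (hasDerivWithinAt_const s (Icc 0 L) ω)
    simp only [inner_zero_right, zero_add] at h1
    exact (uniqueDiffOn_Icc hL s hsI).eq_deriv _ h1
      ((hasDerivWithinAt_const s (Icc 0 L) (0 : ℝ)).congr_of_mem hzero hsI)
  rcases hk with ⟨k, hkd, hne⟩ | ⟨k, hkd, hne⟩
  · exact hne (hcontra s₁ hs₁m k hkd)
  · exact hne (hcontra s₂ hs₂m k hkd)
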